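/- Let $Y_1,Y_2,\dots$ and $Z_1,Z_2,\dots$ be real random variables such that, for each $i$, $Y_i$ and $Z_i$ are independent, $Y_i$ has density $f$ and $Z_i$ has density $k$, and such that the observations $X_i=Y_i+Z_i$ are i.i.d. with ${\rm E}\,X_i^2<\infty$. Let $\phi_k(t)=\int e^{itz}k(z)\,dz$. Condition W: $w$ is a kernel whose Fourier transform (characteristic function) $\phi_w$ is integrable, real valued and symmetric, and vanishes outside $[-1,1]$; that is, $w(u)=\frac1{2\pi}\int e^{-itu}\phi_w(t)\,dt$ for almost every $u$. Moreover $\phi_w(0)=1$ and $\phi_w(1-t)=At^\alpha+o(t^\alpha)$ as $t\downarrow0$, for some real $A$ and some $\alpha\ge0$. Condition K: $\phi_k(t)\ne0$ for all $t$, and $\phi_k(t)\sim C|t|^{\lambda_0}e^{-|t|^\lambda/\mu}$ as $|t|\to\infty$, for some $\lambda>1$, $\mu>0$ and real $\lambda_0$, $C$ (necessarily $C\neq0$). For $n\ge1$, a bandwidth $h>0$ and $x\in\mathbb R$, let $$f_{nh}(x)=\frac1{2\pi}\int_{-\infty}^\infty e^{-itx}\,\frac{\phi_w(ht)\,\phi_{emp}(t)}{\phi_k(t)}\,dt,\qquad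 \phi_{emp}(t)=\frac1n\sum_{j=1}^n e^{itX_j},$$ which is a real number. Then, for every sequence of bandwidths $h=h_n>0$ with $h_n\to0$ and every $x\in\mathbb R$, the random variable $f_{nh}(x)$ is integrable, and as $n\to\infty$ $$\frac{\sqrt n}{h^{\lambda(1+\alpha)+\lambda_0-1}\,e^{1/(\mu h^\lambda)}}\,\bigl(f_{nh}(x)-{\rm E}\,f_{nh}(x)\bigr)\ \stackrel{\mathcal D}{\longrightarrow}\ N\Bigl(0,\ \frac{A^2}{2\pi^2C^2}\Bigl(\frac{\mu}{\lambda}\Bigr)^{2+2\alpha}\Gamma(\alpha+1)^2\Bigr),$$ where $N(0,0)$ is the point mass at $0$. -/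

import Mathlib

open MeasureTheory ProbabilityTheory Filter Topology Asymptotics

noncomputable section

namespace Deconvolution

/-- The measure on the real line with Lebesgue density `k`. -/
def densityMeasure (k : ℝ → ℝ) : Measure ℝ :=
  volume.withDensity fun z => ENNReal.ofReal (k z)

/-- The characteristic function `t ↦ ∫ e^{itz} k(z) dz` of a density `k`. -/
def densityCharFun (k : ℝ → ℝ) : ℝ → ℂ :=
  charFun (densityMeasure k)

/-- The empirical characteristic function `(1/n) ∑_{j ≤ n} e^{itX_j}` of the first `n` terms
(numbered from zero) of the sequence `X`. -/
def empCharFun (n : ℕ) (X : ℕ → ℝ) (t : ℝ) : ℂ :=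
  (1 / (n : ℂ)) * ∑ j ∈ Finset.range n, Complex.exp (Complex.I * t * X j)

/-- The integral `(1/2π) ∫ e^{-itx} φ_w(ht) φ_emp(t) / φ_k(t) dt`. -/
def estimatorIntegral (φw : ℝ → ℝ) (k : ℝ → ℝ) (n : ℕ) (h : ℝ) (X : ℕ → ℝ) (x : ℝ) : ℂ :=
  (1 / (2 * (Real.pi : ℂ))) *
    ∫ t : ℝ, Complex.exp (-(Complex.I * t * x)) *
      ((φw (h * t) : ℂ) * empCharFun n X t / densityCharFun k t)

/-- The kernel deconvolution density estimator `f_{nh}(x)` computed from the sample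
`X 0, …, X (n - 1)`, as a real number. For an even real `φw` the integral is itself real, see
`estimatorIntegral_eq_ofReal`. -/
def estimator (φw : ℝ → ℝ) (k : ℝ → ℝ) (n : ℕ) (h : ℝ) (X : ℕ → ℝ) (x : ℝ) : ℝ :=
  (estimatorIntegral φw k n h X x).re

/-- For an even real-valued `φw` the integral that defines the estimator is real. -/
theorem estimatorIntegral_eq_ofReal (φw : ℝ → ℝ) (hφw : ∀ t, φw (-t) = φw t) (k : ℝ → ℝ)
    (n : ℕ) (h : ℝ) (X : ℕ → ℝ) (x : ℝ) :
    estimatorIntegral φw k n h X x = (estimator φw k n h X x : ℂ) := by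
  symm
  unfold estimator
  rw [← Complex.conj_eq_iff_re]
  unfold estimatorIntegral
  rw [map_mul, ← integral_conj, ← integral_neg_eq_self]
  congr 1
  · simp [Complex.conj_ofNat]
  · congr 1
    funext t
    have h1 : densityCharFun k (-t) = (starRingEnd ℂ) (densityCharFun k t) := by
      simp [densityCharFun, charFun_neg]
    have h2 : empCharFun n X (-t) = (starRingEnd ℂ) (empCharFun n X t) := by
      simp [empCharFun, ← Complex.exp_conj]
    have h3 : φw (h * -t) = φw (h * t) := by rw [mul_neg, hφw]
    simp only [h1, h2, h3, map_mul, map_div₀, Complex.conj_conj, ← Complex.exp_conj,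
      Complex.conj_ofReal, map_neg, Complex.conj_I]
    congr 2
    push_cast
    ring

/-- `φw` is the characteristic function (Fourier transform) of the kernel `w`, in the sense of
Fourier inversion: `φw` is integrable and `w(u) = (1/2π) ∫ e^{-itu} φw(t) dt` for almost every `u`.
When the Fourier transform has compact support this covers the absolutely integrable kernels as
well as those that are merely square integrable, such as the sinc kernel `sin u / (π u)`,
whose transform is the indicator of `[-1, 1]`. -/
structure IsKernelTransform (w φw : ℝ → ℝ) : Prop where
  integrable : Integrable φw
  inversion : ∀ᵐ u : ℝ, (w u : ℂ) =
    (1 / (2 * (Real.pi : ℂ))) * ∫ t : ℝ, Complex.exp (-(Complex.I * t * u)) * (φw t : ℂ)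

/-- Condition W on the kernel `w` with (real-valued) characteristic function `φw`. -/
structure ConditionW (w φw : ℝ → ℝ) (A α : ℝ) : Prop where
  transform : IsKernelTransform w φw
  symmetric : ∀ t, φw (-t) = φw t
  support : Function.support φw ⊆ Set.Icc (-1) 1
  map_zero : φw 0 = 1
  alpha_nonneg : 0 ≤ α
  expansion : (fun t : ℝ => φw (1 - t) - A * t ^ α) =o[𝓝[>] (0 : ℝ)] fun t : ℝ => t ^ α

/-- Condition K on the error density `k`; `cocompact ℝ` is the filter `|t| → ∞`. -/
structure ConditionK (k : ℝ → ℝ) (C lam0 lam mu : ℝ) : Prop where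
  lam_gt_one : 1 < lam
  mu_pos : 0 < mu
  equivalent : densityCharFun k ~[cocompact ℝ]
    fun t : ℝ => ((C * |t| ^ lam0 * Real.exp (-(|t| ^ lam) / mu) : ℝ) : ℂ)
  ne_zero : ∀ t, densityCharFun k t ≠ 0

/-- The deconvolution model: the observations `X i = Y i + Z i` are independent (and then i.i.d.),
`Y i` and `Z i` are independent, `Y i` has density `f` and `Z i` has density `k`. -/
structure Model {Ω : Type*} [MeasurableSpace Ω] (P : Measure Ω) (X Y Z : ℕ → Ω → ℝ)
    (f k : ℝ → ℝ) : Prop where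
  measurable_f : Measurable f
  f_nonneg : ∀ y, 0 ≤ f y
  measurable_k : Measurable k
  k_nonneg : ∀ z, 0 ≤ k z
  measurable_Y : ∀ i, Measurable (Y i)
  measurable_Z : ∀ i, Measurable (Z i)
  law_Y : ∀ i, P.map (Y i) = densityMeasure f
  law_Z : ∀ i, P.map (Z i) = densityMeasure k
  indep_YZ : ∀ i, IndepFun (Y i) (Z i) P
  X_eq : ∀ i ω, X i ω = Y i ω + Z i ω
  indep_X : iIndepFun X P

end Deconvolution

end

/-! The estimator is the average of `deconvKernel` at the points X_j - x, so the task is to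
understand that kernel as h → 0. Since 1/φ_k grows like e^{|t|^λ/μ}, up to powers, while φ_w(ht)
vanishes for |t| > 1/h, the Fourier integral is dominated by t near ±1/h. With s = 1 - ht, the
exponential there decays like e^{-λs/(μh^λ)} and φ_w contributes A s^α. Laplace's method at the
scale s ~ h^λ then produces a Gamma integral, equal after normalisation to L = (A/C)(μ/λ)^{1+α}
Γ(α+1). The phase e^{ity} differs from e^{iy/h} by at most |y|s/h, of order |y|h^{λ-1}, which is
negligible because λ > 1. Hence the normalised kernel is (L/π) cos(y/h) plus a remainder o(1)(1 +
|y|): see `tendsto_integral_and_moment_normalizedIntegrand` and `abs_deconvKernel_div_sub_le`.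

The characteristic function of X is dominated by that of the noise, so it vanishes at infinity. Thus
(X - x)/h behaves like a uniform phase: its cosine has mean tending to 0 and second moment tending
to 1/2. The cosines are bounded, and `tendstoInDistribution_of_bounded_array` gives a normal limit
of variance L²/(2π²), however h depends on n. As E X² is finite, the remainder tends to zero in L²,
so its normalised centred sums vanish in probability by `tendstoInMeasure_of_tendsto_second_moment`,
and Slutsky's theorem concludes. -/

namespace Deconvolution

/-! ### Limit theorems for row-wise i.i.d. arrays. -/

section CentralLimit

variable {Ω : Type*} [MeasurableSpace Ω] {P : Measure Ω} [IsProbabilityMeasure P]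

/-- Second order expansion of the characteristic function of a centred bounded variable. -/
lemma norm_charFun_sub_le_of_bounded {Y : Ω → ℝ} {M : ℝ} (hY : Measurable Y)
    (hM : ∀ ω, |Y ω| ≤ M) (h0 : ∫ ω, Y ω ∂P = 0) (s : ℝ) :
    ‖charFun (P.map Y) s - (1 + ((-(s ^ 2 * ∫ ω, Y ω ^ 2 ∂P) / 2 : ℝ) : ℂ))‖
      ≤ (|s| * M) ^ 3 * Real.exp (|s| * M) := by
  have hYi : Integrable Y P := Integrable.of_bound hY.aestronglyMeasurable M (ae_of_all _ hM)
  have hY2 : Integrable (fun ω => Y ω ^ 2) P := by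
    refine Integrable.of_bound (by fun_prop) (M ^ 2) (ae_of_all _ fun ω => ?_)
    rw [norm_pow, Real.norm_eq_abs]
    gcongr
    exact hM ω
  have hE : Integrable (fun ω => Complex.exp (s * Y ω * Complex.I)) P := by
    refine Integrable.of_bound (by fun_prop) 1 (ae_of_all _ fun ω => ?_)
    rw [← Complex.ofReal_mul, Complex.norm_exp_ofReal_mul_I]
  have hT : Integrable (fun ω => (1 : ℂ) + ((s * Y ω : ℝ) : ℂ) * Complex.I
      + ((-(s ^ 2 * Y ω ^ 2) / 2 : ℝ) : ℂ)) P := by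
    refine ((integrable_const _).add ?_).add ?_
    · exact ((hYi.const_mul s).ofReal).mul_const _
    · exact (((hY2.const_mul (s ^ 2)).neg).div_const 2).ofReal
  have hcf : charFun (P.map Y) s = ∫ ω, Complex.exp (s * Y ω * Complex.I) ∂P := by
    rw [charFun_apply_real, integral_map hY.aemeasurable (by fun_prop)]
  have hpoly : (1 + ((-(s ^ 2 * ∫ ω, Y ω ^ 2 ∂P) / 2 : ℝ) : ℂ))
      = ∫ ω, ((1 : ℂ) + ((s * Y ω : ℝ) : ℂ) * Complex.I
        + ((-(s ^ 2 * Y ω ^ 2) / 2 : ℝ) : ℂ)) ∂P := by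
    rw [integral_add ((integrable_const _).add (((hYi.const_mul s).ofReal).mul_const _))
      (((hY2.const_mul (s ^ 2)).neg).div_const 2).ofReal,
      integral_add (integrable_const _) (((hYi.const_mul s).ofReal).mul_const _),
      integral_mul_const, integral_complex_ofReal, integral_complex_ofReal, integral_const_mul, h0,
      integral_div, integral_neg, integral_const_mul]
    simp
  rw [hcf, hpoly, ← integral_sub hE hT]
  refine (norm_integral_le_of_norm_le_const (C := (|s| * M) ^ 3 * Real.exp (|s| * M))
    (ae_of_all _ fun ω => ?_)).trans (by simp)
  -- Pointwise Taylor expansion to second order; the linear term has already disappeared from the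
  -- integrated polynomial because the mean is zero.
  have h1 := Complex.norm_exp_sub_sum_le_norm_mul_exp (s * Y ω * Complex.I) 3
  have h2 : ‖(s * Y ω * Complex.I : ℂ)‖ ≤ |s| * M := by
    simp only [norm_mul, Complex.norm_real, Complex.norm_I, mul_one, Real.norm_eq_abs]
    gcongr
    exact hM ω
  have h3 : (∑ m ∈ Finset.range 3, (s * Y ω * Complex.I : ℂ) ^ m / (m.factorial : ℂ))
      = (1 : ℂ) + ((s * Y ω : ℝ) : ℂ) * Complex.I + ((-(s ^ 2 * Y ω ^ 2) / 2 : ℝ) : ℂ) := by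
    simp only [Finset.sum_range_succ, Finset.sum_range_zero, mul_pow, Complex.I_sq,
      Nat.factorial]
    push_cast
    ring
  rw [h3] at h1
  refine h1.trans ?_
  have h4 : 0 ≤ |s| * M := (norm_nonneg _).trans h2
  gcongr

/-- A central limit theorem for triangular arrays `g n (X 0), …, g n (X (n - 1))` with uniformly
bounded `g n`, means tending to zero and second moments tending to `v`. -/
theorem tendstoInDistribution_of_bounded_array {X : ℕ → Ω → ℝ} (hX : ∀ i, Measurable (X i))
    (hind : iIndepFun X P) (hlaw : ∀ i, P.map (X i) = P.map (X 0))
    {g : ℕ → ℝ → ℝ} (hg : ∀ n, Measurable (g n)) {M : ℝ} (hM : ∀ n y, |g n y| ≤ M)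
    (h1 : Tendsto (fun n => ∫ ω, g n (X 0 ω) ∂P) atTop (𝓝 0)) {v : ℝ} (hv : 0 ≤ v)
    (h2 : Tendsto (fun n => ∫ ω, g n (X 0 ω) ^ 2 ∂P) atTop (𝓝 v)) :
    TendstoInDistribution
      (fun (n : ℕ) (ω : Ω) => (Real.sqrt n)⁻¹ * ∑ j ∈ Finset.range n,
        (g n (X j ω) - ∫ ω', g n (X 0 ω') ∂P))
      atTop (id : ℝ → ℝ) (fun _ => P) (gaussianReal 0 v.toNNReal) where
  forall_aemeasurable n := by
    refine Measurable.aemeasurable ?_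
    exact measurable_const.mul (Finset.measurable_sum _ fun j _ =>
      ((hg n).comp (hX j)).sub_const _)
  tendsto := by
    refine ProbabilityMeasure.tendsto_iff_tendsto_charFun.2 fun t => ?_
    set m : ℕ → ℝ := fun n => ∫ ω, g n (X 0 ω) ∂P with hm
    have hM0 : 0 ≤ M := (abs_nonneg _).trans (hM 0 0)
    have hgi : ∀ n, Integrable (fun ω => g n (X 0 ω)) P := fun n =>
      Integrable.of_bound ((hg n).comp (hX 0)).aestronglyMeasurable M (ae_of_all _ fun ω => hM n _)
    have hg2i : ∀ n, Integrable (fun ω => g n (X 0 ω) ^ 2) P := fun n => by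
      refine Integrable.of_bound (((hg n).comp (hX 0)).pow_const 2).aestronglyMeasurable (M ^ 2)
        (ae_of_all _ fun ω => ?_)
      rw [norm_pow, Real.norm_eq_abs]
      gcongr
      exact hM n _
    have hmM : ∀ n, |m n| ≤ M := fun n => by
      refine (norm_integral_le_of_norm_le_const (C := M)
        (f := fun ω => g n (X 0 ω)) (ae_of_all _ fun ω => hM n (X 0 ω))).trans ?_
      simp
    set G : ℕ → ℝ → ℝ := fun n y => g n y - m n with hG
    have hGm : ∀ n, Measurable (G n) := fun n => (hg n).sub_const _
    have hGM : ∀ n y, |G n y| ≤ 2 * M := fun n y => by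
      refine (abs_sub _ _).trans ?_
      linarith [hM n y, hmM n]
    have hG0 : ∀ n, ∫ ω, G n (X 0 ω) ∂P = 0 := fun n => by
      simp only [hG]
      rw [integral_sub (hgi n) (integrable_const _)]
      simp [hm]
    have hG2 : ∀ n, ∫ ω, G n (X 0 ω) ^ 2 ∂P = (∫ ω, g n (X 0 ω) ^ 2 ∂P) - m n ^ 2 := fun n => by
      have : ∀ ω, G n (X 0 ω) ^ 2 = g n (X 0 ω) ^ 2 - 2 * m n * g n (X 0 ω) + m n ^ 2 :=
        fun ω => by simp only [hG]; ring
      simp only [this]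
      have hi : Integrable (fun ω => g n (X 0 ω) ^ 2 - 2 * m n * g n (X 0 ω)) P :=
        (hg2i n).sub ((hgi n).const_mul _)
      rw [integral_add hi (integrable_const _), integral_sub (hg2i n) ((hgi n).const_mul _), integral_const_mul]
      simp only [integral_const, probReal_univ, smul_eq_mul, one_mul]
      change _ - 2 * m n * m n + _ = _
      ring
    have hvar : Tendsto (fun n => ∫ ω, G n (X 0 ω) ^ 2 ∂P) atTop (𝓝 v) := by
      simp only [hG2]
      simpa using h2.sub (h1.pow 2)
    have hcf : ∀ n : ℕ, charFun (P.map (fun ω => (Real.sqrt n)⁻¹ * ∑ j ∈ Finset.range n,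
        G n (X j ω))) t = (charFun (P.map (fun ω => G n (X 0 ω))) ((Real.sqrt n)⁻¹ * t)) ^ n := by
      intro n
      refine charFun_inv_sqrt_mul_sum (X := fun j ω => G n (X j ω))
        (hind.comp (fun _ => G n) fun _ => hGm n) fun i => ?_
      exact (IdentDistrib.mk (hX i).aemeasurable (hX 0).aemeasurable (hlaw i)).comp (hGm n)
    have hlim : Tendsto (fun n : ℕ =>
        (charFun (P.map (fun ω => G n (X 0 ω))) ((Real.sqrt n)⁻¹ * t)) ^ n) atTop
        (𝓝 (Complex.exp ((-(t ^ 2 * v) / 2 : ℝ) : ℂ))) := by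
      -- It suffices that the base equals 1 - t²v/(2n) + o(1/n). After multiplication by n, the
      -- cubic remainder is of order n^{-1/2}, and replacing the row variance by v costs t²/2 times
      -- their difference.
      refine Complex.tendsto_pow_exp_of_isLittleO_sub_add_div _ ?_
      rw [isLittleO_iff_tendsto' ?_]
      swap
      · filter_upwards [eventually_gt_atTop 0] with n hn h
        simp [hn.ne'] at h
      rw [tendsto_zero_iff_norm_tendsto_zero]
      have hsq : Tendsto (fun n : ℕ => (Real.sqrt n)⁻¹) atTop (𝓝 0) :=
        tendsto_inv_atTop_zero.comp (Real.tendsto_sqrt_atTop.comp tendsto_natCast_atTop_atTop)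
      have hb : Tendsto (fun n : ℕ => (Real.sqrt n)⁻¹ * ((|t| * (2 * M)) ^ 3 *
          Real.exp ((Real.sqrt n)⁻¹ * (|t| * (2 * M))))
          + t ^ 2 / 2 * |v - ∫ ω, G n (X 0 ω) ^ 2 ∂P|) atTop (𝓝 0) := by
        have a1 : Tendsto (fun n : ℕ => (Real.sqrt n)⁻¹ * ((|t| * (2 * M)) ^ 3 *
          Real.exp ((Real.sqrt n)⁻¹ * (|t| * (2 * M))))) atTop
            (𝓝 (0 * ((|t| * (2 * M)) ^ 3 * Real.exp (0 * (|t| * (2 * M)))))) :=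
          hsq.mul (((hsq.mul_const _).rexp).const_mul _)
        have a2 : Tendsto (fun n : ℕ => t ^ 2 / 2 * |v - ∫ ω, G n (X 0 ω) ^ 2 ∂P|) atTop
            (𝓝 (t ^ 2 / 2 * |v - v|)) := ((hvar.const_sub v).abs).const_mul _
        simpa using a1.add a2
      refine squeeze_zero' (Eventually.of_forall fun _ => norm_nonneg _) ?_ hb
      filter_upwards [eventually_gt_atTop 0] with n hn
      have hn' : (0 : ℝ) < n := by exact_mod_cast hn
      have hs : 0 < Real.sqrt n := Real.sqrt_pos.2 hn'
      have hss : Real.sqrt n * Real.sqrt n = n := Real.mul_self_sqrt hn'.le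
      have key := norm_charFun_sub_le_of_bounded (P := P) ((hGm n).comp (hX 0))
        (fun ω => hGM n (X 0 ω)) (hG0 n) ((Real.sqrt n)⁻¹ * t)
      simp only [Function.comp_apply] at key
      set W := ∫ ω, G n (X 0 ω) ^ 2 ∂P
      have e1 : ((Real.sqrt n)⁻¹ * t) ^ 2 * W = t ^ 2 * W / n := by
        rw [mul_pow, inv_pow, sq (Real.sqrt n), hss]; field_simp
      have e2 : |(Real.sqrt n)⁻¹ * t| = (Real.sqrt n)⁻¹ * |t| := by
        rw [abs_mul, abs_of_pos (inv_pos.2 hs)]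
      rw [e1, e2] at key
      rw [norm_div, norm_div, norm_one, Complex.norm_natCast, div_div_eq_mul_div, div_one]
      have tri : ‖charFun (P.map (fun ω => G n (X 0 ω))) ((Real.sqrt n)⁻¹ * t) -
          (1 + ((-(t ^ 2 * v) / 2 : ℝ) : ℂ) / n)‖ ≤
          (((Real.sqrt n)⁻¹ * |t| * (2 * M)) ^ 3 * Real.exp ((Real.sqrt n)⁻¹ * |t| * (2 * M)))
          + t ^ 2 / 2 * |v - W| / n := by
        have e3 : charFun (P.map (fun ω => G n (X 0 ω))) ((Real.sqrt n)⁻¹ * t) -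
          (1 + ((-(t ^ 2 * v) / 2 : ℝ) : ℂ) / n) =
          (charFun (P.map (fun ω => G n (X 0 ω))) ((Real.sqrt n)⁻¹ * t) -
            (1 + ((-(t ^ 2 * W / n) / 2 : ℝ) : ℂ))) + ((t ^ 2 / 2 * (v - W) / n : ℝ) : ℂ) := by
          push_cast; ring
        rw [e3]
        refine (norm_add_le _ _).trans (add_le_add key ?_)
        rw [Complex.norm_real, Real.norm_eq_abs, abs_div, abs_mul, abs_of_pos hn',
          abs_of_nonneg (by positivity : 0 ≤ t ^ 2 / 2)]
      refine (mul_le_mul_of_nonneg_right tri hn'.le).trans (le_of_eq ?_)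
      rw [add_mul, div_mul_cancel₀ _ hn'.ne']
      congr 1
      rw [mul_assoc (Real.sqrt n)⁻¹ |t|, mul_pow]
      have e4 : ((Real.sqrt n)⁻¹) ^ 3 * n = (Real.sqrt n)⁻¹ := by
        calc ((Real.sqrt n)⁻¹) ^ 3 * n = ((Real.sqrt n)⁻¹) ^ 3 * (Real.sqrt n * Real.sqrt n) := by
              rw [hss]
          _ = (Real.sqrt n)⁻¹ := by
              generalize Real.sqrt n = q at hs
              field_simp
      linear_combination (|t| * (2 * M)) ^ 3 *
        Real.exp ((Real.sqrt n)⁻¹ * (|t| * (2 * M))) * e4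
    have : charFun ((gaussianReal 0 v.toNNReal).map (id : ℝ → ℝ)) t
        = Complex.exp ((-(t ^ 2 * v) / 2 : ℝ) : ℂ) := by
      rw [Measure.map_id, charFun_gaussianReal]
      congr 1
      simp [Real.coe_toNNReal v hv]
      ring
    simp only [ProbabilityMeasure.coe_mk]
    rw [this]
    exact hlim.congr fun n => (hcf n).symm

/-- Normalised centred sums of an array with vanishing second moments tend to zero in
probability. -/
theorem tendstoInMeasure_of_tendsto_second_moment {X : ℕ → Ω → ℝ} (hX : ∀ i, Measurable (X i))
    (hind : iIndepFun X P) (hlaw : ∀ i, P.map (X i) = P.map (X 0))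
    {R : ℕ → ℝ → ℝ} (hR : ∀ n, Measurable (R n)) (hL : ∀ n, MemLp (fun ω => R n (X 0 ω)) 2 P)
    (h2 : Tendsto (fun n => ∫ ω, R n (X 0 ω) ^ 2 ∂P) atTop (𝓝 0)) :
    TendstoInMeasure P
      (fun (n : ℕ) (ω : Ω) => (Real.sqrt n)⁻¹ * ∑ j ∈ Finset.range n,
        (R n (X j ω) - ∫ ω', R n (X 0 ω') ∂P)) atTop (fun _ => (0 : ℝ)) := by
  have hid : ∀ n j, IdentDistrib (fun ω => R n (X j ω)) (fun ω => R n (X 0 ω)) P P := fun n j =>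
    (IdentDistrib.mk (hX j).aemeasurable (hX 0).aemeasurable (hlaw j)).comp (hR n)
  have hLj : ∀ n j, MemLp (fun ω => R n (X j ω)) 2 P := fun n j => (hid n j).memLp_iff.2 (hL n)
  rw [tendstoInMeasure_iff_norm]
  intro ε hε
  -- Chebyshev's inequality: the factor 1/√n makes the variance of the normalised sum at most the
  -- variance of one summand.
  have hb : Tendsto (fun n => ENNReal.ofReal ((∫ ω, R n (X 0 ω) ^ 2 ∂P) / ε ^ 2)) atTop (𝓝 0) := by
    have := ENNReal.tendsto_ofReal (h2.div_const (ε ^ 2))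
    simpa using this
  refine tendsto_of_tendsto_of_tendsto_of_le_of_le tendsto_const_nhds hb (fun _ => zero_le) ?_
  intro n
  set c := ∫ ω', R n (X 0 ω') ∂P with hc
  set S : Ω → ℝ := fun ω => (Real.sqrt n)⁻¹ * ∑ j ∈ Finset.range n, (R n (X j ω) - c) with hS
  have hT : ∀ j ∈ Finset.range n, MemLp (fun ω => R n (X j ω) - c) 2 P :=
    fun j _ => (hLj n j).sub (memLp_const c)
  have hSL : MemLp S 2 P := (memLp_finsetSum _ hT).const_mul _
  have hS0 : ∫ ω, S ω ∂P = 0 := by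
    simp only [hS]
    rw [integral_const_mul, integral_finsetSum _ fun j hj =>
      (hT j hj).integrable one_le_two]
    rw [Finset.sum_eq_zero, mul_zero]
    intro j _
    rw [integral_sub ((hLj n j).integrable one_le_two) (integrable_const _), (hid n j).integral_eq]
    simp [hc]
  have hvar : variance S P ≤ ∫ ω, R n (X 0 ω) ^ 2 ∂P := by
    have e1 : variance (∑ j ∈ Finset.range n, fun ω => R n (X j ω) - c) P
        = n * variance (fun ω => R n (X 0 ω)) P := by
      rw [IndepFun.variance_sum hT]
      · have : ∀ j ∈ Finset.range n, variance (fun ω => R n (X j ω) - c) P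
            = variance (fun ω => R n (X 0 ω)) P := fun j _ => by
          rw [variance_sub_const ((hLj n j).aestronglyMeasurable), (hid n j).variance_eq]
        rw [Finset.sum_congr rfl this]
        simp
      · intro i _ j _ hij
        exact (hind.indepFun hij).comp ((hR n).sub_const c) ((hR n).sub_const c)
    have e2 : variance S P = (Real.sqrt n)⁻¹ ^ 2 * (n * variance (fun ω => R n (X 0 ω)) P) := by
      rw [← e1, ← variance_const_mul]
      congr 1
      ext ω
      simp [hS]
    have e3 : variance (fun ω => R n (X 0 ω)) P ≤ ∫ ω, R n (X 0 ω) ^ 2 ∂P :=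
      variance_le_expectation_sq (hL n).aestronglyMeasurable
    rw [e2]
    -- For n = 0 the sum is empty and its variance is zero.
    rcases Nat.eq_zero_or_pos n with h0 | h0
    · subst h0
      simpa using integral_nonneg fun ω => sq_nonneg _
    · have hn' : (0 : ℝ) < n := by exact_mod_cast h0
      rw [inv_pow, Real.sq_sqrt hn'.le, inv_mul_cancel_left₀ hn'.ne']
      exact e3
  have := meas_ge_le_variance_div_sq hSL hε
  rw [hS0] at this
  simp only [sub_zero] at this
  simp only [sub_zero, Real.norm_eq_abs]
  refine this.trans (ENNReal.ofReal_le_ofReal ?_)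
  gcongr

end CentralLimit

/-! ### Pointwise asymptotics and majorants for the integrand. -/

section LaplaceAsymptotics

variable {w φw k : ℝ → ℝ} {A α C lam0 lam mu : ℝ}

/-- A function asymptotically equivalent to zero is eventually zero, which a nowhere vanishing
function cannot be. -/
lemma ConditionK.C_ne_zero (hK : ConditionK k C lam0 lam mu) : C ≠ 0 := by
  rintro rfl
  have h1 : densityCharFun k ~[cocompact ℝ] 0 := by
    refine hK.equivalent.congr_right (Eventually.of_forall fun t => ?_)
    simp
  obtain ⟨t, ht⟩ := (isEquivalent_zero_iff_eventually_zero.1 h1).exists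
  exact hK.ne_zero t ht

lemma tendsto_rpow_mul_exp_neg_rpow_div (lam0 : ℝ) {lam mu : ℝ} (hlam : 0 < lam) (hmu : 0 < mu) :
    Tendsto (fun t : ℝ => t ^ lam0 * Real.exp (-(t ^ lam) / mu)) atTop (𝓝 0) := by
  have h1 := (tendsto_rpow_mul_exp_neg_mul_atTop_nhds_zero (lam0 / lam) mu⁻¹
    (inv_pos.2 hmu)).comp (tendsto_rpow_atTop hlam)
  refine h1.congr' ?_
  filter_upwards [eventually_gt_atTop 0] with t ht
  simp only [Function.comp_apply]
  rw [← Real.rpow_mul ht.le, mul_div_cancel₀ _ hlam.ne']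
  congr 2
  field_simp

/-- The characteristic function of the error density vanishes at infinity. -/
lemma ConditionK.tendsto_zero (hK : ConditionK k C lam0 lam mu) :
    Tendsto (densityCharFun k) (cocompact ℝ) (𝓝 0) := by
  refine hK.equivalent.symm.tendsto_nhds ?_
  have h1 := ((tendsto_rpow_mul_exp_neg_rpow_div lam0 (zero_lt_one.trans hK.lam_gt_one)
    hK.mu_pos).comp (tendsto_norm_cocompact_atTop (E := ℝ))).const_mul C
  rw [mul_zero] at h1
  have h2 := (Complex.continuous_ofReal.tendsto 0).comp h1
  rw [Complex.ofReal_zero] at h2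
  refine h2.congr fun t => ?_
  simp [mul_assoc]

lemma ConditionK.tendsto_ratio (hK : ConditionK k C lam0 lam mu) :
    Tendsto (fun t : ℝ => ((|t| ^ lam0 * Real.exp (-(|t| ^ lam) / mu) : ℝ) : ℂ)
      * (densityCharFun k t)⁻¹) (cocompact ℝ) (𝓝 ((C : ℂ)⁻¹)) := by
  have h1 := (isEquivalent_iff_tendsto_one (Eventually.of_forall hK.ne_zero)).1 hK.equivalent.symm
  have h2 := h1.const_mul ((C : ℂ)⁻¹)
  rw [mul_one] at h2
  refine h2.congr fun t => ?_
  have hC : (C : ℂ) ≠ 0 := by exact_mod_cast hK.C_ne_zero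
  simp only [Pi.div_apply]
  push_cast
  field_simp

/-- A bound for the reciprocal of the characteristic function that holds everywhere. -/
lemma ConditionK.exists_norm_inv_le (hK : ConditionK k C lam0 lam mu)
    (hc : Continuous (densityCharFun k)) :
    ∃ B : ℝ, 0 ≤ B ∧ ∀ t, ‖(densityCharFun k t)⁻¹‖
      ≤ B * ((1 + |t|) ^ |lam0| * Real.exp (|t| ^ lam / mu)) := by
  have hev : ∀ᶠ t in cocompact ℝ, ‖((|t| ^ lam0 * Real.exp (-(|t| ^ lam) / mu) : ℝ) : ℂ)
      * (densityCharFun k t)⁻¹‖ < ‖(C : ℂ)⁻¹‖ + 1 ∧ 1 ≤ |t| :=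
    (hK.tendsto_ratio.norm.eventually_lt_const (lt_add_one _)).and
      ((tendsto_norm_cocompact_atTop (E := ℝ)).eventually_ge_atTop 1)
  obtain ⟨K, hKc, hKs⟩ := mem_cocompact.1 hev
  obtain ⟨B, hB⟩ := hKc.exists_bound_of_continuousOn
    (hc.inv₀ hK.ne_zero).continuousOn
  -- Continuity controls the compact set `K`, the asymptotic ratio its complement. The inner maximum
  -- with 0 is needed because `B` may be negative when `K` is empty.
  refine ⟨max (max B 0) (‖(C : ℂ)⁻¹‖ + 1), le_max_of_le_left (le_max_right _ _), fun t => ?_⟩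
  have hbase : 1 ≤ (1 + |t|) ^ |lam0| :=
    Real.one_le_rpow (by linarith [abs_nonneg t]) (abs_nonneg _)
  have hexp : 1 ≤ Real.exp (|t| ^ lam / mu) :=
    Real.one_le_exp (div_nonneg (Real.rpow_nonneg (abs_nonneg _) _) hK.mu_pos.le)
  by_cases ht : t ∈ K
  · refine (hB t ht).trans
      (((le_max_left B 0).trans (le_max_left _ (‖(C : ℂ)⁻¹‖ + 1))).trans ?_)
    refine le_mul_of_one_le_right (le_max_of_le_left (le_max_right _ _)) ?_
    exact one_le_mul_of_one_le_of_one_le hbase hexp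
  · obtain ⟨h1, h2⟩ := hKs ht
    have ht0 : 0 < |t| := zero_lt_one.trans_le h2
    have hp : 0 < |t| ^ lam0 * Real.exp (-(|t| ^ lam) / mu) :=
      mul_pos (Real.rpow_pos_of_pos ht0 _) (Real.exp_pos _)
    rw [norm_mul, Complex.norm_real, Real.norm_of_nonneg hp.le] at h1
    have h3 : 1 ≤ (|t| ^ lam0 * Real.exp (-(|t| ^ lam) / mu)) *
        ((1 + |t|) ^ |lam0| * Real.exp (|t| ^ lam / mu)) := by
      -- The power with exponent |λ₀| compensates the model's power whatever the sign of λ₀.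
      have e1 : (1 : ℝ) ≤ |t| ^ lam0 * (1 + |t|) ^ |lam0| := by
        calc (1 : ℝ) ≤ |t| ^ (lam0 + |lam0|) :=
              Real.one_le_rpow h2 (by linarith [neg_abs_le lam0])
          _ = |t| ^ lam0 * |t| ^ |lam0| := Real.rpow_add ht0 _ _
          _ ≤ _ := by gcongr; linarith
      have e2 : Real.exp (-(|t| ^ lam) / mu) * Real.exp (|t| ^ lam / mu) = 1 := by
        rw [← Real.exp_add, neg_div, neg_add_cancel, Real.exp_zero]
      calc (1 : ℝ) ≤ |t| ^ lam0 * (1 + |t|) ^ |lam0| := e1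
        _ = (|t| ^ lam0 * (1 + |t|) ^ |lam0|) *
            (Real.exp (-(|t| ^ lam) / mu) * Real.exp (|t| ^ lam / mu)) := by rw [e2, mul_one]
        _ = _ := by ring
    set a := |t| ^ lam0 * Real.exp (-(|t| ^ lam) / mu)
    set b := (1 + |t|) ^ |lam0| * Real.exp (|t| ^ lam / mu)
    have hb0 : 0 ≤ b := by positivity
    calc ‖(densityCharFun k t)⁻¹‖ ≤ ‖(densityCharFun k t)⁻¹‖ * (a * b) :=
          le_mul_of_one_le_right (norm_nonneg _) h3
      _ = a * ‖(densityCharFun k t)⁻¹‖ * b := by ring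
      _ ≤ (‖(C : ℂ)⁻¹‖ + 1) * b := by gcongr
      _ ≤ _ := by gcongr; exact le_max_right _ _

/-- The integrand of the deconvolution kernel in the variable `s = 1 - h t`, normalised so that
its integral over `(0, 1)` converges as the bandwidth tends to zero. -/
noncomputable def normalizedIntegrand (φw k : ℝ → ℝ) (α lam0 lam mu h s : ℝ) : ℂ :=
  ((h ^ (-(lam * (1 + α) + lam0)) * Real.exp (-(1 / (mu * h ^ lam))) * φw (1 - s) : ℝ) : ℂ)
    * (densityCharFun k ((1 - s) / h))⁻¹

/-- Multiplying and dividing by the model for φ_k at (1 - s)/h isolates a ratio that tends to 1/C.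
The normalising exponential combines with the model's into the exponent 1 - (1 - s)^λ, which
vanishes at s = 0. -/
lemma normalizedIntegrand_eq {h s : ℝ} (hh : 0 < h) (hs : s < 1) :
    normalizedIntegrand φw k α lam0 lam mu h s =
      ((h ^ (-(lam * (1 + α))) * φw (1 - s) * (1 - s) ^ (-lam0) *
        Real.exp (-((1 - (1 - s) ^ lam) / (mu * h ^ lam))) : ℝ) : ℂ) *
      (((|(1 - s) / h| ^ lam0 * Real.exp (-(|(1 - s) / h| ^ lam) / mu) : ℝ) : ℂ)
        * (densityCharFun k ((1 - s) / h))⁻¹) := by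
  have hu : 0 < 1 - s := by linarith
  unfold normalizedIntegrand
  rw [← mul_assoc, ← Complex.ofReal_mul]
  congr 2
  rw [abs_of_pos (div_pos hu hh), Real.div_rpow hu.le hh.le, Real.div_rpow hu.le hh.le]
  have e1 : h ^ (-(lam * (1 + α) + lam0)) = h ^ (-(lam * (1 + α))) / h ^ lam0 := by
    rw [neg_add, Real.rpow_add hh, Real.rpow_neg hh.le lam0, div_eq_mul_inv]
  have e2 : Real.exp (-(1 / (mu * h ^ lam))) =
      Real.exp (-((1 - (1 - s) ^ lam) / (mu * h ^ lam))) *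
        Real.exp (-((1 - s) ^ lam / h ^ lam) / mu) := by
    rw [← Real.exp_add]
    congr 1
    rw [neg_div, div_div, mul_comm (h ^ lam) mu, sub_div]
    ring
  rw [e1, e2, Real.rpow_neg hu.le]
  have h3 : (1 - s) ^ lam0 ≠ 0 := (Real.rpow_pos_of_pos hu _).ne'
  field_simp

lemma integrable_normalizedIntegrand (hW : ConditionW w φw A α) (hK : ConditionK k C lam0 lam mu)
    (hc : Continuous (densityCharFun k)) (h : ℝ) :
    Integrable (normalizedIntegrand φw k α lam0 lam mu h) := by
  have hsupp : Function.support (normalizedIntegrand φw k α lam0 lam mu h) ⊆ Set.Icc 0 2 := by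
    intro s hs
    have h1 : φw (1 - s) ≠ 0 := fun h0 => hs (by simp [normalizedIntegrand, h0])
    have h2 := hW.support h1
    constructor <;> linarith [h2.1, h2.2]
  rw [← integrableOn_iff_integrable_of_support_subset hsupp]
  have h1 : IntegrableOn (fun s => ((h ^ (-(lam * (1 + α) + lam0)) *
      Real.exp (-(1 / (mu * h ^ lam))) * φw (1 - s) : ℝ) : ℂ)) (Set.Icc 0 2) :=
    (((hW.transform.integrable.comp_sub_left 1).const_mul _).ofReal).integrableOn
  have h2 : ContinuousOn (fun s => (densityCharFun k ((1 - s) / h))⁻¹) (Set.Icc 0 2) :=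
    ((hc.comp (by fun_prop : Continuous fun s : ℝ => (1 - s) / h)).inv₀
      fun s => hK.ne_zero _).continuousOn
  refine (h1.continuousOn_mul h2 isCompact_Icc).congr_fun (fun s _ => ?_) measurableSet_Icc
  simp only [normalizedIntegrand]
  ring

/-- Near the endpoint `s = 0` the normalised integrand has a Gamma density type majorant. -/
lemma exists_norm_normalizedIntegrand_le (hW : ConditionW w φw A α)
    (hK : ConditionK k C lam0 lam mu) :
    ∃ δ M : ℝ, 0 < δ ∧ δ < 1 ∧ 0 ≤ M ∧ ∀ᶠ h in 𝓝[>] (0 : ℝ), ∀ s ∈ Set.Ioo 0 δ,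
      ‖normalizedIntegrand φw k α lam0 lam mu h s‖
        ≤ M * (h ^ (-(lam * (1 + α))) * s ^ α * Real.exp (-(s / (mu * h ^ lam)))) := by
  have h1 : ∀ᶠ t in 𝓝[>] (0 : ℝ), |φw (1 - t)| ≤ (|A| + 1) * t ^ α := by
    filter_upwards [hW.expansion.bound one_pos, self_mem_nhdsWithin] with t ht ht0
    have hp : 0 ≤ t ^ α := Real.rpow_nonneg (le_of_lt ht0) _
    rw [one_mul, Real.norm_eq_abs, Real.norm_eq_abs, abs_of_nonneg hp] at ht
    calc |φw (1 - t)| = |(φw (1 - t) - A * t ^ α) + A * t ^ α| := by ring_nf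
      _ ≤ |φw (1 - t) - A * t ^ α| + |A * t ^ α| := abs_add_le _ _
      _ ≤ t ^ α + |A| * t ^ α := by
          rw [abs_mul, abs_of_nonneg hp]
          gcongr
      _ = _ := by ring
  obtain ⟨ε, hε, hεs⟩ := mem_nhdsGT_iff_exists_Ioo_subset.1 h1
  have hev : ∀ᶠ t : ℝ in atTop, ‖((|t| ^ lam0 * Real.exp (-(|t| ^ lam) / mu) : ℝ) : ℂ)
      * (densityCharFun k t)⁻¹‖ < ‖(C : ℂ)⁻¹‖ + 1 :=
    (hK.tendsto_ratio.mono_left atTop_le_cocompact).norm.eventually_lt_const (lt_add_one _)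
  obtain ⟨T, hT⟩ := eventually_atTop.1 hev
  have hbig : ∀ᶠ h in 𝓝[>] (0 : ℝ), T ≤ 1 / 2 / h :=
    (Tendsto.const_mul_atTop (by norm_num : (0 : ℝ) < 1 / 2)
      tendsto_inv_nhdsGT_zero).eventually_ge_atTop T
  -- `ε` is the range of the bound on φ_w, and s < 1/2 keeps (1 - s)/h beyond `T`. The factors of
  -- the constant bound φ_w(1 - s)/s^α, (1 - s)^{-λ₀} and the ratio for φ_k.
  refine ⟨min ε (1 / 2), (|A| + 1) * 2 ^ |lam0| * (‖(C : ℂ)⁻¹‖ + 1), lt_min hε (by norm_num),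
    (min_le_right _ _).trans_lt (by norm_num), by positivity, ?_⟩
  filter_upwards [hbig, self_mem_nhdsWithin] with h hh (h0 : 0 < h) s hs
  have hs0 : 0 < s := hs.1
  have hs2 : s < 1 / 2 := hs.2.trans_le (min_le_right _ _)
  have hw : |φw (1 - s)| ≤ (|A| + 1) * s ^ α := hεs ⟨hs0, hs.2.trans_le (min_le_left _ _)⟩
  have hu : 0 < 1 - s := by linarith
  rw [normalizedIntegrand_eq h0 (by linarith), norm_mul, Complex.norm_real, Real.norm_eq_abs]
  have hr := hT ((1 - s) / h) (hh.trans (by gcongr; linarith))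
  have hpw : (1 - s) ^ (-lam0) ≤ 2 ^ |lam0| := by
    calc (1 - s) ^ (-lam0) ≤ (1 - s) ^ (-|lam0|) :=
          Real.rpow_le_rpow_of_exponent_ge hu (by linarith) (neg_le_neg (le_abs_self _))
      _ ≤ (1 / 2) ^ (-|lam0|) :=
          Real.rpow_le_rpow_of_nonpos (by norm_num) (by linarith) (neg_nonpos.2 (abs_nonneg _))
      _ = 2 ^ |lam0| := by
          rw [one_div, Real.inv_rpow (by norm_num), Real.rpow_neg (by norm_num), inv_inv]
  -- Since λ ≥ 1 and 0 < 1 - s < 1, one has 1 - (1 - s)^λ ≥ s.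
  have hex : Real.exp (-((1 - (1 - s) ^ lam) / (mu * h ^ lam)))
      ≤ Real.exp (-(s / (mu * h ^ lam))) := by
    have hden : 0 < mu * h ^ lam := mul_pos hK.mu_pos (Real.rpow_pos_of_pos h0 _)
    have : (1 - s) ^ lam ≤ (1 - s) ^ (1 : ℝ) :=
      Real.rpow_le_rpow_of_exponent_ge hu (by linarith) hK.lam_gt_one.le
    rw [Real.rpow_one] at this
    gcongr
    linarith
  rw [abs_mul, abs_mul, abs_mul, abs_of_pos (Real.exp_pos _),
    abs_of_pos (Real.rpow_pos_of_pos h0 _), abs_of_pos (Real.rpow_pos_of_pos hu _)]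
  have hh' := (Real.rpow_pos_of_pos h0 (-(lam * (1 + α)))).le
  have hs' := (Real.rpow_pos_of_pos hs0 α).le
  calc _ ≤ h ^ (-(lam * (1 + α))) * ((|A| + 1) * s ^ α) * 2 ^ |lam0| *
        Real.exp (-(s / (mu * h ^ lam))) * (‖(C : ℂ)⁻¹‖ + 1) := by
        gcongr
    _ = _ := by ring

/-- At s = h^λ v the exponent (1 - (1 - s)^λ)/(μh^λ) tends to λv/μ, from the derivative of (1 - s)^λ
at 0, and φ_w(1 - s) ~ A s^α gives v^α. The prefactor h^λ is the Jacobian. -/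
lemma tendsto_normalizedIntegrand (hW : ConditionW w φw A α) (hK : ConditionK k C lam0 lam mu)
    {v : ℝ} (hv : 0 < v) :
    Tendsto (fun h : ℝ => ((h ^ lam : ℝ) : ℂ) *
        normalizedIntegrand φw k α lam0 lam mu h (h ^ lam * v)) (𝓝[>] 0)
      (𝓝 (((A / C * (v ^ α * Real.exp (-(lam / mu * v))) : ℝ)) : ℂ)) := by
  have hlam : 0 < lam := zero_lt_one.trans hK.lam_gt_one
  have hmu := hK.mu_pos
  have hpow : Tendsto (fun h : ℝ => h ^ lam) (𝓝[>] 0) (𝓝 0) := by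
    have := (Real.continuousAt_rpow_const 0 lam (Or.inr hlam.le)).tendsto
    rw [Real.zero_rpow hlam.ne'] at this
    exact this.mono_left nhdsWithin_le_nhds
  have hs : Tendsto (fun h : ℝ => h ^ lam * v) (𝓝[>] 0) (𝓝[>] 0) := by
    refine tendsto_nhdsWithin_iff.2 ⟨by simpa using hpow.mul_const v, ?_⟩
    filter_upwards [self_mem_nhdsWithin] with h (h0 : 0 < h)
    exact mul_pos (Real.rpow_pos_of_pos h0 _) hv
  have hs' : Tendsto (fun h : ℝ => h ^ lam * v) (𝓝[>] 0) (𝓝 0) := hs.mono_right nhdsWithin_le_nhds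
  have c1 : Tendsto (fun s : ℝ => φw (1 - s) / s ^ α) (𝓝[>] 0) (𝓝 A) := by
    have h1 := hW.expansion.tendsto_div_nhds_zero.add_const A
    rw [zero_add] at h1
    refine h1.congr' ?_
    filter_upwards [self_mem_nhdsWithin] with t (ht : 0 < t)
    have := (Real.rpow_pos_of_pos ht α).ne'
    field_simp
    ring
  have c2 : Tendsto (fun s : ℝ => (1 - s) ^ (-lam0)) (𝓝 0) (𝓝 1) := by
    have : ContinuousAt (fun s : ℝ => (1 - s) ^ (-lam0)) 0 :=
      ContinuousAt.rpow_const (by fun_prop) (Or.inl (by norm_num))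
    simpa using this.tendsto
  have c3 : Tendsto (fun s : ℝ => (1 - (1 - s) ^ lam) / s) (𝓝[>] 0) (𝓝 lam) := by
    have hd : HasDerivAt (fun s : ℝ => (1 - s) ^ lam) (-lam) 0 := by
      have := ((hasDerivAt_id (0 : ℝ)).const_sub 1).rpow_const (p := lam) (Or.inl (by simp))
      simpa using this
    have := (hasDerivAt_iff_tendsto_slope_zero.1 hd).neg
    rw [neg_neg] at this
    refine (this.mono_left (nhdsWithin_mono _ fun x (hx : 0 < x) => hx.ne')).congr fun t => ?_
    simp
    ring
  have c4 : Tendsto (fun h : ℝ => (1 - h ^ lam * v) / h) (𝓝[>] 0) atTop := by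
    have : Tendsto (fun h : ℝ => 1 - h ^ lam * v) (𝓝[>] 0) (𝓝 1) := by
      simpa using hs'.const_sub 1
    exact this.pos_mul_atTop one_pos tendsto_inv_nhdsGT_zero
  have c5 := (hK.tendsto_ratio.mono_left atTop_le_cocompact).comp c4
  have c6 : Tendsto (fun h : ℝ => ((φw (1 - h ^ lam * v) / (h ^ lam * v) ^ α * v ^ α *
      (1 - h ^ lam * v) ^ (-lam0) *
      Real.exp (-((1 - (1 - h ^ lam * v) ^ lam) / (h ^ lam * v) * (v / mu))) : ℝ) : ℂ)) (𝓝[>] 0)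
      (𝓝 ((A * v ^ α * 1 * Real.exp (-(lam * (v / mu))) : ℝ) : ℂ)) := by
    refine (Complex.continuous_ofReal.tendsto _).comp ?_
    exact (((c1.comp hs).mul_const _).mul (c2.comp hs')).mul
      ((((c3.comp hs).mul_const _).neg).rexp)
  have c7 := c6.mul c5
  have hlim : ((A * v ^ α * 1 * Real.exp (-(lam * (v / mu))) : ℝ) : ℂ) * (C : ℂ)⁻¹ =
      (((A / C * (v ^ α * Real.exp (-(lam / mu * v))) : ℝ)) : ℂ) := by
    rw [← Complex.ofReal_inv, ← Complex.ofReal_mul]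
    congr 1
    rw [show lam * (v / mu) = lam / mu * v by ring]
    ring
  rw [hlim] at c7
  refine c7.congr' ?_
  filter_upwards [self_mem_nhdsWithin, hs'.eventually_lt_const one_pos] with h (h0 : 0 < h) h1
  rw [normalizedIntegrand_eq h0 h1, ← mul_assoc, ← Complex.ofReal_mul]
  simp only [Function.comp_apply]
  congr 2
  have hl : 0 < h ^ lam := Real.rpow_pos_of_pos h0 _
  have e1 : h ^ (-(lam * (1 + α))) = (h ^ lam)⁻¹ * ((h ^ lam) ^ α)⁻¹ := by
    rw [← Real.rpow_mul h0.le, ← Real.rpow_neg h0.le, ← Real.rpow_neg h0.le, ← Real.rpow_add h0]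
    congr 1
    ring
  have e2 : (1 - (1 - h ^ lam * v) ^ lam) / (h ^ lam * v) * (v / mu) =
      (1 - (1 - h ^ lam * v) ^ lam) / (mu * h ^ lam) := by
    field_simp
  rw [e1, e2, Real.mul_rpow hl.le hv.le]
  have h3 := (Real.rpow_pos_of_pos hl α).ne'
  have h4 := (Real.rpow_pos_of_pos hv α).ne'
  field_simp

end LaplaceAsymptotics

/-! ### Convergence of the integral and smallness of the first moment. -/

section LaplaceIntegrals

variable {w φw k : ℝ → ℝ} {A α C lam0 lam mu : ℝ}

lemma tendsto_rpow_mul_exp_neg_div_rpow (p : ℝ) {c lam : ℝ} (hc : 0 < c) (hlam : 0 < lam) :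
    Tendsto (fun h : ℝ => h ^ (-p) * Real.exp (-(c / h ^ lam))) (𝓝[>] 0) (𝓝 0) := by
  have h1 := (tendsto_rpow_mul_exp_neg_mul_atTop_nhds_zero (p / lam) c hc).comp
    (tendsto_rpow_neg_nhdsGT_zero (neg_lt_zero.2 hlam))
  refine h1.congr' ?_
  filter_upwards [self_mem_nhdsWithin] with h (h0 : 0 < h)
  simp only [Function.comp_apply]
  rw [← Real.rpow_mul h0.le, Real.rpow_neg h0.le lam]
  congr 2
  · field_simp
  · ring

lemma integrableOn_rpow_mul_exp_neg_mul {a r : ℝ} (ha : -1 < a) (hr : 0 < r) :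
    IntegrableOn (fun s : ℝ => s ^ a * Real.exp (-(r * s))) (Set.Ioi 0) := by
  refine (integrableOn_rpow_mul_exp_neg_mul_rpow ha one_pos hr).congr_fun (fun s _ => ?_)
    measurableSet_Ioi
  simp

/-- Dominated convergence after s = h^λ v. In this variable the Gamma type majorant no longer
depends on h, and the pointwise limit integrates to a Gamma function. -/
lemma tendsto_integral_normalizedIntegrand_near (hW : ConditionW w φw A α)
    (hK : ConditionK k C lam0 lam mu) (hc : Continuous (densityCharFun k)) {δ M : ℝ} (hδ : 0 < δ)
    (hM0 : 0 ≤ M)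
    (hM : ∀ᶠ h in 𝓝[>] (0 : ℝ), ∀ s ∈ Set.Ioo 0 δ,
      ‖normalizedIntegrand φw k α lam0 lam mu h s‖
        ≤ M * (h ^ (-(lam * (1 + α))) * s ^ α * Real.exp (-(s / (mu * h ^ lam))))) :
    Tendsto (fun h => ∫ s in Set.Ioo 0 δ, normalizedIntegrand φw k α lam0 lam mu h s) (𝓝[>] 0)
      (𝓝 ((A / C * (mu / lam) ^ (1 + α) * Real.Gamma (α + 1) : ℝ) : ℂ)) := by
  have hlam : 0 < lam := zero_lt_one.trans hK.lam_gt_one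
  have hmu := hK.mu_pos
  have hα := hW.alpha_nonneg
  -- The cutoff turns the h-dependent range of v into the fixed half-line.
  set G : ℝ → ℝ → ℂ := fun h => (Set.Ioo 0 δ).indicator
    (normalizedIntegrand φw k α lam0 lam mu h) with hG
  have hGi : ∀ h, Integrable (G h) := fun h =>
    (integrable_normalizedIntegrand hW hK hc h).indicator measurableSet_Ioo
  have hint : ∀ h : ℝ, 0 < h → ∫ s in Set.Ioo 0 δ, normalizedIntegrand φw k α lam0 lam mu h s
      = ∫ v in Set.Ioi (0 : ℝ), ((h ^ lam : ℝ) : ℂ) * G h (h ^ lam * v) := by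
    intro h h0
    have hl : 0 < h ^ lam := Real.rpow_pos_of_pos h0 _
    rw [integral_const_mul, integral_comp_mul_left_Ioi (G h) 0 hl, mul_zero, Complex.real_smul,
      ← mul_assoc, ← Complex.ofReal_mul, mul_inv_cancel₀ hl.ne', Complex.ofReal_one, one_mul, hG,
      setIntegral_indicator measurableSet_Ioo,
      Set.inter_eq_self_of_subset_right Set.Ioo_subset_Ioi_self]
  have hval : ∫ v in Set.Ioi (0 : ℝ), ((A / C * (v ^ α * Real.exp (-(lam / mu * v))) : ℝ) : ℂ)
      = ((A / C * (mu / lam) ^ (1 + α) * Real.Gamma (α + 1) : ℝ) : ℂ) := by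
    rw [integral_complex_ofReal, integral_const_mul]
    have := Real.integral_rpow_mul_exp_neg_mul_Ioi (a := α + 1) (r := lam / mu) (by linarith)
      (div_pos hlam hmu)
    rw [add_sub_cancel_right] at this
    rw [this, one_div_div, add_comm α 1, mul_assoc]
  rw [← hval]
  have hlim : Tendsto (fun h => ∫ v in Set.Ioi (0 : ℝ), ((h ^ lam : ℝ) : ℂ) * G h (h ^ lam * v))
      (𝓝[>] 0) (𝓝 (∫ v in Set.Ioi (0 : ℝ),
        ((A / C * (v ^ α * Real.exp (-(lam / mu * v))) : ℝ) : ℂ))) := by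
    refine tendsto_integral_filter_of_dominated_convergence
      (fun v => M * (v ^ α * Real.exp (-(mu⁻¹ * v)))) ?_ ?_ ?_ ?_
    · filter_upwards [self_mem_nhdsWithin] with h (h0 : 0 < h)
      exact (((hGi h).comp_mul_left' (Real.rpow_pos_of_pos h0 lam).ne').const_mul
        _).aestronglyMeasurable.restrict
    · filter_upwards [hM, self_mem_nhdsWithin] with h hh (h0 : 0 < h)
      have hl : 0 < h ^ lam := Real.rpow_pos_of_pos h0 _
      refine (ae_restrict_iff' measurableSet_Ioi).2 (ae_of_all _ fun v (hv : 0 < v) => ?_)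
      have hpos : 0 ≤ M * (v ^ α * Real.exp (-(mu⁻¹ * v))) := by positivity
      by_cases hvs : h ^ lam * v ∈ Set.Ioo 0 δ
      · rw [norm_mul, Complex.norm_real, Real.norm_of_nonneg hl.le, hG]
        simp only [Set.indicator_of_mem hvs]
        refine (mul_le_mul_of_nonneg_left (hh _ hvs) hl.le).trans (le_of_eq ?_)
        have e1 : h ^ (-(lam * (1 + α))) = (h ^ lam)⁻¹ * ((h ^ lam) ^ α)⁻¹ := by
          rw [← Real.rpow_mul h0.le, ← Real.rpow_neg h0.le, ← Real.rpow_neg h0.le,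
            ← Real.rpow_add h0]
          congr 1
          ring
        have e2 : h ^ lam * v / (mu * h ^ lam) = mu⁻¹ * v := by field_simp
        rw [e1, e2, Real.mul_rpow hl.le hv.le]
        have h3 := (Real.rpow_pos_of_pos hl α).ne'
        field_simp
      · rw [hG]
        simpa only [Set.indicator_of_notMem hvs, mul_zero, norm_zero] using hpos
    · exact (integrableOn_rpow_mul_exp_neg_mul (by linarith) (inv_pos.2 hmu)).const_mul M
    · refine (ae_restrict_iff' measurableSet_Ioi).2 (ae_of_all _ fun v (hv : 0 < v) => ?_)
      refine (tendsto_normalizedIntegrand hW hK hv).congr' ?_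
      have hs' : Tendsto (fun h : ℝ => h ^ lam * v) (𝓝[>] 0) (𝓝 0) := by
        have := (Real.continuousAt_rpow_const 0 lam (Or.inr hlam.le)).tendsto.mul_const v
        rw [Real.zero_rpow hlam.ne', zero_mul] at this
        exact this.mono_left nhdsWithin_le_nhds
      filter_upwards [self_mem_nhdsWithin, hs'.eventually_lt_const hδ] with h (h0 : 0 < h) h1
      have hvs : h ^ lam * v ∈ Set.Ioo 0 δ := ⟨mul_pos (Real.rpow_pos_of_pos h0 _) hv, h1⟩
      rw [hG]
      simp only [Set.indicator_of_mem hvs]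
  refine hlim.congr' ?_
  filter_upwards [self_mem_nhdsWithin] with h (h0 : 0 < h)
  exact (hint h h0).symm

/-- The majorant's first moment over the half-line is a Gamma integral of order h^λ; division by h
leaves h^{λ-1}, which tends to zero because λ > 1. -/
lemma tendsto_moment_normalizedIntegrand_near (hW : ConditionW w φw A α)
    (hK : ConditionK k C lam0 lam mu) {δ M : ℝ} (hM0 : 0 ≤ M)
    (hM : ∀ᶠ h in 𝓝[>] (0 : ℝ), ∀ s ∈ Set.Ioo 0 δ,
      ‖normalizedIntegrand φw k α lam0 lam mu h s‖
        ≤ M * (h ^ (-(lam * (1 + α))) * s ^ α * Real.exp (-(s / (mu * h ^ lam))))) :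
    Tendsto (fun h => h⁻¹ * ∫ s in Set.Ioo 0 δ, s * ‖normalizedIntegrand φw k α lam0 lam mu h s‖)
      (𝓝[>] 0) (𝓝 0) := by
  have hlam : 0 < lam := zero_lt_one.trans hK.lam_gt_one
  have hmu := hK.mu_pos
  have hα := hW.alpha_nonneg
  have hb : Tendsto (fun h : ℝ => M * (mu ^ (α + 2) * Real.Gamma (α + 2)) * h ^ (lam - 1))
      (𝓝[>] 0) (𝓝 0) := by
    have hp : 0 < lam - 1 := sub_pos.2 hK.lam_gt_one
    have := ((Real.continuousAt_rpow_const 0 (lam - 1) (Or.inr hp.le)).tendsto.const_mul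
      (M * (mu ^ (α + 2) * Real.Gamma (α + 2))))
    rw [Real.zero_rpow hp.ne', mul_zero] at this
    exact this.mono_left nhdsWithin_le_nhds
  refine squeeze_zero' ?_ ?_ hb
  · filter_upwards [self_mem_nhdsWithin] with h (h0 : 0 < h)
    exact mul_nonneg (inv_nonneg.2 h0.le)
      (setIntegral_nonneg measurableSet_Ioo fun s hs => mul_nonneg hs.1.le (norm_nonneg _))
  · filter_upwards [hM, self_mem_nhdsWithin] with h hh (h0 : 0 < h)
    have hl : 0 < h ^ lam := Real.rpow_pos_of_pos h0 _
    have hr : 0 < (mu * h ^ lam)⁻¹ := inv_pos.2 (mul_pos hmu hl)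
    have hi : IntegrableOn (fun s : ℝ => M * h ^ (-(lam * (1 + α))) *
        (s ^ (α + 1) * Real.exp (-((mu * h ^ lam)⁻¹ * s)))) (Set.Ioi 0) :=
      (integrableOn_rpow_mul_exp_neg_mul (by linarith) hr).const_mul _
    have h1 : ∫ s in Set.Ioo 0 δ, s * ‖normalizedIntegrand φw k α lam0 lam mu h s‖ ≤
        ∫ s in Set.Ioo 0 δ, M * h ^ (-(lam * (1 + α))) *
          (s ^ (α + 1) * Real.exp (-((mu * h ^ lam)⁻¹ * s))) := by
      refine integral_mono_of_nonneg ?_ (hi.mono_set Set.Ioo_subset_Ioi_self) ?_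
      · exact (ae_restrict_iff' measurableSet_Ioo).2 (ae_of_all _ fun s hs =>
          mul_nonneg hs.1.le (norm_nonneg _))
      · refine (ae_restrict_iff' measurableSet_Ioo).2 (ae_of_all _ fun s hs => ?_)
        refine (mul_le_mul_of_nonneg_left (hh s hs) hs.1.le).trans (le_of_eq ?_)
        beta_reduce
        rw [Real.rpow_add_one hs.1.ne', div_eq_inv_mul]
        ring
    have h2 : ∫ s in Set.Ioo 0 δ, M * h ^ (-(lam * (1 + α))) *
          (s ^ (α + 1) * Real.exp (-((mu * h ^ lam)⁻¹ * s))) ≤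
        ∫ s in Set.Ioi 0, M * h ^ (-(lam * (1 + α))) *
          (s ^ (α + 1) * Real.exp (-((mu * h ^ lam)⁻¹ * s))) := by
      refine setIntegral_mono_set hi ?_ (Eventually.of_forall Set.Ioo_subset_Ioi_self)
      refine (ae_restrict_iff' measurableSet_Ioi).2 (ae_of_all _ fun s (hs : 0 < s) => ?_)
      simp only [Pi.zero_apply]
      positivity
    have h3 : ∫ s in Set.Ioi 0, M * h ^ (-(lam * (1 + α))) *
          (s ^ (α + 1) * Real.exp (-((mu * h ^ lam)⁻¹ * s))) =
        M * h ^ (-(lam * (1 + α))) * ((mu * h ^ lam) ^ (α + 2) * Real.Gamma (α + 2)) := by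
      have := Real.integral_rpow_mul_exp_neg_mul_Ioi (a := α + 2) (by linarith) hr
      rw [show α + 2 - 1 = α + 1 by ring] at this
      rw [integral_const_mul, this, one_div, inv_inv]
    refine (mul_le_mul_of_nonneg_left ((h1.trans h2).trans h3.le) (inv_nonneg.2 h0.le)).trans
      (le_of_eq ?_)
    have e1 : h ^ (lam - 1) = h⁻¹ * (h ^ (-(lam * (1 + α))) * (h ^ lam) ^ (α + 2)) := by
      rw [← Real.rpow_mul h0.le, ← Real.rpow_add h0, ← Real.rpow_neg_one, ← Real.rpow_add h0]
      congr 1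
      ring
    rw [e1, Real.mul_rpow hmu.le hl.le]
    ring

/-- For s ≥ δ one has 1 - (1 - s)^λ ≥ δ, so a factor e^{-δ/(μh^λ)} appears, which beats every power
of 1/h. Only integrability of φ_w is available on this range. -/
lemma tendsto_integral_norm_normalizedIntegrand_far (hW : ConditionW w φw A α)
    (hK : ConditionK k C lam0 lam mu) (hc : Continuous (densityCharFun k)) {δ : ℝ} (hδ : 0 < δ) :
    Tendsto (fun h => h⁻¹ * ∫ s in Set.Ico δ 1, ‖normalizedIntegrand φw k α lam0 lam mu h s‖)
      (𝓝[>] 0) (𝓝 0) := by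
  have hlam : 0 < lam := zero_lt_one.trans hK.lam_gt_one
  have hmu := hK.mu_pos
  obtain ⟨B, hB0, hB⟩ := hK.exists_norm_inv_le hc
  set N := ∫ s in Set.Ico δ 1, |φw (1 - s)| with hN
  have hb : Tendsto (fun h : ℝ => B * 2 ^ |lam0| * N *
      (h ^ (-(lam * (1 + α) + lam0 + |lam0| + 1)) * Real.exp (-(δ / mu / h ^ lam))))
      (𝓝[>] 0) (𝓝 0) := by
    simpa using (tendsto_rpow_mul_exp_neg_div_rpow (lam * (1 + α) + lam0 + |lam0| + 1)
      (div_pos hδ hmu) hlam).const_mul (B * 2 ^ |lam0| * N)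
  have hle1 : ∀ᶠ h : ℝ in 𝓝[>] 0, h < 1 :=
    nhdsWithin_le_nhds (eventually_lt_nhds one_pos)
  refine squeeze_zero' ?_ ?_ hb
  · filter_upwards [self_mem_nhdsWithin] with h (h0 : 0 < h)
    exact mul_nonneg (inv_nonneg.2 h0.le) (integral_nonneg fun s => norm_nonneg _)
  · filter_upwards [hle1, self_mem_nhdsWithin] with h hh1 (h0 : 0 < h)
    have hl : 0 < h ^ lam := Real.rpow_pos_of_pos h0 _
    have hm : 0 < mu * h ^ lam := mul_pos hmu hl
    -- Worst case over s in [δ, 1): for h < 1, 1 + (1 - s)/h ≤ 2/h and (1 - s)^λ ≤ 1 - δ.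
    set c := h ^ (-(lam * (1 + α) + lam0)) * Real.exp (-(1 / (mu * h ^ lam))) *
      (B * ((2 / h) ^ |lam0| * Real.exp ((1 - δ) / (mu * h ^ lam)))) with hcdef
    have hc0 : 0 ≤ c := by positivity
    have h1 : ∫ s in Set.Ico δ 1, ‖normalizedIntegrand φw k α lam0 lam mu h s‖ ≤
        ∫ s in Set.Ico δ 1, c * |φw (1 - s)| := by
      refine integral_mono_of_nonneg (ae_of_all _ fun s => norm_nonneg _)
        (((hW.transform.integrable.comp_sub_left 1).abs.integrableOn).const_mul c) ?_
      refine (ae_restrict_iff' measurableSet_Ico).2 (ae_of_all _ fun s hs => ?_)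
      have hu : 0 < 1 - s := by linarith [hs.2]
      have hu1 : 1 - s ≤ 1 := by linarith [hs.1]
      have habs : |(1 - s) / h| = (1 - s) / h := abs_of_pos (div_pos hu h0)
      have e1 : (1 + |(1 - s) / h|) ^ |lam0| ≤ (2 / h) ^ |lam0| := by
        refine Real.rpow_le_rpow (by positivity) ?_ (abs_nonneg _)
        rw [habs, show (2 : ℝ) / h = 1 / h + 1 / h by ring]
        gcongr
        exact (one_le_div h0).2 hh1.le
      have e2 : Real.exp (|(1 - s) / h| ^ lam / mu) ≤ Real.exp ((1 - δ) / (mu * h ^ lam)) := by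
        rw [habs, Real.div_rpow hu.le h0.le, div_div, mul_comm (h ^ lam)]
        gcongr
        calc (1 - s) ^ lam ≤ (1 - s) ^ (1 : ℝ) :=
              Real.rpow_le_rpow_of_exponent_ge hu hu1 hK.lam_gt_one.le
          _ ≤ 1 - δ := by rw [Real.rpow_one]; linarith [hs.1]
      have e3 : ‖(densityCharFun k ((1 - s) / h))⁻¹‖ ≤
          B * ((2 / h) ^ |lam0| * Real.exp ((1 - δ) / (mu * h ^ lam))) := by
        refine (hB _).trans ?_
        gcongr
      simp only [normalizedIntegrand]
      rw [norm_mul, Complex.norm_real, Real.norm_eq_abs, abs_mul,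
        abs_of_pos (mul_pos (Real.rpow_pos_of_pos h0 _) (Real.exp_pos _)), hcdef]
      have hh' := (Real.rpow_pos_of_pos h0 (-(lam * (1 + α) + lam0))).le
      calc _ ≤ h ^ (-(lam * (1 + α) + lam0)) * Real.exp (-(1 / (mu * h ^ lam))) *
            |φw (1 - s)| * (B * ((2 / h) ^ |lam0| * Real.exp ((1 - δ) / (mu * h ^ lam)))) := by
            gcongr
        _ = _ := by ring
    rw [integral_const_mul, ← hN] at h1
    refine (mul_le_mul_of_nonneg_left h1 (inv_nonneg.2 h0.le)).trans (le_of_eq ?_)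
    have e4 : h ^ (-(lam * (1 + α) + lam0 + |lam0| + 1)) =
        h⁻¹ * (h ^ (-(lam * (1 + α) + lam0)) * (h ^ |lam0|)⁻¹) := by
      rw [← Real.rpow_neg h0.le, ← Real.rpow_add h0, ← Real.rpow_neg_one, ← Real.rpow_add h0]
      congr 1
      ring
    have e5 : Real.exp (-(δ / mu / h ^ lam)) =
        Real.exp (-(1 / (mu * h ^ lam))) * Real.exp ((1 - δ) / (mu * h ^ lam)) := by
      rw [← Real.exp_add, div_div]
      congr 1
      ring
    rw [e4, e5, hcdef, Real.div_rpow zero_le_two h0.le]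
    ring

lemma setIntegral_Ioo_zero_one_split {E : Type*} [NormedAddCommGroup E] [NormedSpace ℝ E]
    {F : ℝ → E} (hF : IntegrableOn F (Set.Ioo 0 1)) {δ : ℝ} (hδ : 0 < δ) (hδ1 : δ < 1) :
    ∫ s in Set.Ioo 0 1, F s = (∫ s in Set.Ioo 0 δ, F s) + ∫ s in Set.Ico δ 1, F s := by
  rw [← Set.Ioo_union_Ico_eq_Ioo hδ hδ1.le] at hF ⊢
  refine setIntegral_union ?_ measurableSet_Ico (hF.mono_set Set.subset_union_left)
    (hF.mono_set Set.subset_union_right)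
  rw [Set.disjoint_left]
  intro s h1 h2
  exact absurd h1.2 (not_lt.2 h2.1)

/-- The normalised integrand concentrates at the endpoint `s = 0`: its integral converges, and its
first absolute moment is of smaller order than the bandwidth. -/
lemma tendsto_integral_and_moment_normalizedIntegrand (hW : ConditionW w φw A α)
    (hK : ConditionK k C lam0 lam mu) (hc : Continuous (densityCharFun k)) :
    Tendsto (fun h => ∫ s in Set.Ioo 0 1, normalizedIntegrand φw k α lam0 lam mu h s) (𝓝[>] 0)
      (𝓝 ((A / C * (mu / lam) ^ (1 + α) * Real.Gamma (α + 1) : ℝ) : ℂ)) ∧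
    Tendsto (fun h => h⁻¹ * ∫ s in Set.Ioo 0 1, s * ‖normalizedIntegrand φw k α lam0 lam mu h s‖)
      (𝓝[>] 0) (𝓝 0) := by
  obtain ⟨δ, M, hδ, hδ1, hM0, hM⟩ := exists_norm_normalizedIntegrand_le hW hK
  have hfar := tendsto_integral_norm_normalizedIntegrand_far (α := α) hW hK hc hδ
  have hQ := fun h => integrable_normalizedIntegrand (α := α) (lam0 := lam0) (lam := lam)
    (mu := mu) hW hK hc h
  have hsQ : ∀ h, IntegrableOn (fun s => s * ‖normalizedIntegrand φw k α lam0 lam mu h s‖)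
      (Set.Ioo 0 1) := fun h =>
    ((hQ h).norm.integrableOn.continuousOn_mul continuousOn_id isCompact_Icc).mono_set
      Set.Ioo_subset_Icc_self
  constructor
  · have h1 := tendsto_integral_normalizedIntegrand_near hW hK hc hδ hM0 hM
    have h2 : Tendsto (fun h => ∫ s in Set.Ico δ 1, normalizedIntegrand φw k α lam0 lam mu h s)
        (𝓝[>] 0) (𝓝 0) := by
      have hid : Tendsto (fun h : ℝ => h) (𝓝[>] 0) (𝓝 0) := nhdsWithin_le_nhds
      have h3 := hid.mul hfar
      rw [mul_zero] at h3
      refine squeeze_zero_norm' ?_ h3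
      filter_upwards [self_mem_nhdsWithin] with h (h0 : 0 < h)
      rw [mul_inv_cancel_left₀ h0.ne']
      exact norm_integral_le_integral_norm _
    have h3 := h1.add h2
    rw [add_zero] at h3
    exact h3.congr fun h => (setIntegral_Ioo_zero_one_split (hQ h).integrableOn hδ hδ1).symm
  · have h1 := tendsto_moment_normalizedIntegrand_near hW hK hM0 hM
    have h3 := h1.add hfar
    rw [add_zero] at h3
    refine squeeze_zero' ?_ ?_ h3
    · filter_upwards [self_mem_nhdsWithin] with h (h0 : 0 < h)
      exact mul_nonneg (inv_nonneg.2 h0.le)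
        (setIntegral_nonneg measurableSet_Ioo fun s hs => mul_nonneg hs.1.le (norm_nonneg _))
    · filter_upwards [self_mem_nhdsWithin] with h (h0 : 0 < h)
      rw [setIntegral_Ioo_zero_one_split (hsQ h) hδ hδ1, mul_add]
      refine add_le_add le_rfl (mul_le_mul_of_nonneg_left ?_ (inv_nonneg.2 h0.le))
      refine setIntegral_mono_on ((hsQ h).mono_set fun s hs => ⟨hδ.trans_le hs.1, hs.2⟩)
        (hQ h).norm.integrableOn measurableSet_Ico fun s hs => ?_
      exact mul_le_of_le_one_left (norm_nonneg _) hs.2.le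

end LaplaceIntegrals

/-! ### The deconvolution kernel and its cosine approximation. -/

section Kernel

variable {w φw k : ℝ → ℝ} {A α C lam0 lam mu : ℝ}

/-- The integrand of the deconvolution kernel. -/
noncomputable def deconvIntegrand (φw k : ℝ → ℝ) (h y t : ℝ) : ℂ :=
  Complex.exp (Complex.I * t * y) * ((φw (h * t) : ℂ) / densityCharFun k t)

/-- The deconvolution kernel `y ↦ (1/2π) ∫ e^{ity} φ_w(ht) / φ_k(t) dt`; the estimator at `x` is the
average of its values at `X j - x`. -/
noncomputable def deconvKernel (φw k : ℝ → ℝ) (h y : ℝ) : ℝ :=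
  ((1 / (2 * (Real.pi : ℂ))) * ∫ t, deconvIntegrand φw k h y t).re

lemma norm_exp_I_mul_mul (t y : ℝ) : ‖Complex.exp (Complex.I * t * y)‖ = 1 := by
  rw [show Complex.I * t * y = ((t * y : ℝ) : ℂ) * Complex.I by push_cast; ring,
    Complex.norm_exp_ofReal_mul_I]

lemma integrable_deconvIntegrand (hW : ConditionW w φw A α)
    (hK : ConditionK k C lam0 lam mu) (hc : Continuous (densityCharFun k)) {h : ℝ} (hh : 0 < h)
    (y : ℝ) : Integrable (deconvIntegrand φw k h y) := by
  have hsupp : Function.support (deconvIntegrand φw k h y) ⊆ Set.Icc (-1 / h) (1 / h) := by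
    intro t ht
    have h1 : φw (h * t) ≠ 0 := fun h0 => ht (by simp [deconvIntegrand, h0])
    have h2 := hW.support h1
    constructor
    · rw [div_le_iff₀ hh]; linarith [h2.1]
    · rw [le_div_iff₀ hh]; linarith [h2.2]
  rw [← integrableOn_iff_integrable_of_support_subset hsupp]
  have h1 : IntegrableOn (fun t => (φw (h * t) : ℂ)) (Set.Icc (-1 / h) (1 / h)) :=
    ((hW.transform.integrable.comp_mul_left' hh.ne').ofReal).integrableOn
  have h2 : ContinuousOn (fun t : ℝ => Complex.exp (Complex.I * t * y) * (densityCharFun k t)⁻¹)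
      (Set.Icc (-1 / h) (1 / h)) :=
    ((by fun_prop : Continuous fun t : ℝ => Complex.exp (Complex.I * t * y)).mul
      (hc.inv₀ hK.ne_zero)).continuousOn
  refine (h1.continuousOn_mul h2 isCompact_Icc).congr_fun (fun s _ => ?_) measurableSet_Icc
  simp only [deconvIntegrand]
  ring

lemma norm_deconvIntegrand (φw k : ℝ → ℝ) (h y t : ℝ) :
    ‖deconvIntegrand φw k h y t‖ = ‖deconvIntegrand φw k h 0 t‖ := by
  simp only [deconvIntegrand, norm_mul, norm_exp_I_mul_mul]

lemma continuous_deconvKernel (hW : ConditionW w φw A α)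
    (hK : ConditionK k C lam0 lam mu) (hc : Continuous (densityCharFun k)) {h : ℝ} (hh : 0 < h) :
    Continuous (deconvKernel φw k h) := by
  refine Complex.continuous_re.comp (continuous_const.mul ?_)
  refine continuous_of_dominated (bound := fun t => ‖deconvIntegrand φw k h 0 t‖)
    (fun y => (integrable_deconvIntegrand hW hK hc hh y).aestronglyMeasurable)
    (fun y => ae_of_all _ fun t => (norm_deconvIntegrand φw k h y t).le)
    (integrable_deconvIntegrand hW hK hc hh 0).norm (ae_of_all _ fun t => ?_)
  unfold deconvIntegrand
  fun_prop

lemma exists_abs_deconvKernel_le (φw k : ℝ → ℝ) (h : ℝ) :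
    ∃ B, ∀ y, |deconvKernel φw k h y| ≤ B := by
  refine ⟨‖(1 / (2 * (Real.pi : ℂ)))‖ * ∫ t, ‖deconvIntegrand φw k h 0 t‖, fun y => ?_⟩
  refine (Complex.abs_re_le_norm _).trans ?_
  rw [norm_mul]
  gcongr
  refine (norm_integral_le_integral_norm _).trans (le_of_eq ?_)
  simp only [norm_deconvIntegrand φw k h y]

lemma estimator_eq_sum_deconvKernel (hW : ConditionW w φw A α)
    (hK : ConditionK k C lam0 lam mu) (hc : Continuous (densityCharFun k)) {h : ℝ} (hh : 0 < h)
    (n : ℕ) (X : ℕ → ℝ) (x : ℝ) :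
    estimator φw k n h X x = (n : ℝ)⁻¹ * ∑ j ∈ Finset.range n, deconvKernel φw k h (X j - x) := by
  have h1 : (∫ t : ℝ, Complex.exp (-(Complex.I * t * x)) *
      ((φw (h * t) : ℂ) * empCharFun n X t / densityCharFun k t)) =
      ((n : ℝ)⁻¹ : ℝ) * ∑ j ∈ Finset.range n, ∫ t, deconvIntegrand φw k h (X j - x) t := by
    rw [← integral_finsetSum _ fun j _ => integrable_deconvIntegrand hW hK hc hh _,
      ← integral_const_mul]
    congr 1
    funext t
    have h2 : ∀ j, deconvIntegrand φw k h (X j - x) t = Complex.exp (Complex.I * t * X j) *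
        (Complex.exp (-(Complex.I * t * x)) * ((φw (h * t) : ℂ) / densityCharFun k t)) := by
      intro j
      rw [deconvIntegrand, ← mul_assoc, ← Complex.exp_add]
      congr 2
      push_cast
      ring
    simp only [h2, ← Finset.sum_mul, empCharFun]
    push_cast
    ring
  unfold estimator estimatorIntegral
  rw [h1, mul_left_comm, Complex.re_ofReal_mul, Finset.mul_sum, Complex.re_sum]
  rfl

/-- This folds the two critical endpoints t = ±1/h into one. -/
lemma re_integral_eq_two_mul_of_conj {F : ℝ → ℂ} (hF : Integrable F)
    (hconj : ∀ t, F (-t) = (starRingEnd ℂ) (F t)) :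
    (∫ t, F t).re = 2 * (∫ t in Set.Ioi 0, F t).re := by
  have h1 : ∫ t in Set.Iic (0 : ℝ), F t = (starRingEnd ℂ) (∫ t in Set.Ioi 0, F t) := by
    rw [← integral_conj]
    have := integral_comp_neg_Iic (0 : ℝ) fun t => F (-t)
    simp only [neg_neg, neg_zero] at this
    rw [this]
    simp only [hconj]
  rw [← intervalIntegral.integral_Iic_add_Ioi (b := 0) hF.integrableOn hF.integrableOn, h1,
    Complex.add_re, Complex.conj_re]
  ring

lemma deconvIntegrand_neg (hW : ConditionW w φw A α) (h y t : ℝ) :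
    deconvIntegrand φw k h y (-t) = (starRingEnd ℂ) (deconvIntegrand φw k h y t) := by
  have h1 : densityCharFun k (-t) = (starRingEnd ℂ) (densityCharFun k t) := by
    simp [densityCharFun, charFun_neg]
  have h2 : φw (h * -t) = φw (h * t) := by rw [mul_neg, hW.symmetric]
  simp only [deconvIntegrand, h1, h2, map_mul, map_div₀, ← Complex.exp_conj, Complex.conj_ofReal,
    Complex.conj_I]
  congr 2
  push_cast
  ring

/-- The deconvolution kernel in terms of the normalised integrand. -/
lemma deconvKernel_eq (hW : ConditionW w φw A α)
    (hK : ConditionK k C lam0 lam mu) (hc : Continuous (densityCharFun k)) {h : ℝ} (hh : 0 < h)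
    (y : ℝ) :
    deconvKernel φw k h y =
      h ^ (lam * (1 + α) + lam0 - 1) * Real.exp (1 / (mu * h ^ lam)) * (Real.pi⁻¹ *
        (Complex.exp (((y / h : ℝ) : ℂ) * Complex.I) * ∫ s in Set.Ioo 0 1,
          Complex.exp (Complex.I * ((-(s * (y / h)) : ℝ) : ℂ)) *
            normalizedIntegrand φw k α lam0 lam mu h s).re) := by
  set H : ℝ → ℂ := (Set.Ioi 0).indicator (deconvIntegrand φw k h y) with hH
  have hsub : ∫ t in Set.Ioi 0, deconvIntegrand φw k h y t = (h⁻¹ : ℝ) * ∫ s, H ((1 - s) / h) := by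
    rw [integral_sub_left_eq_self (fun u => H (u / h)) volume 1, Measure.integral_comp_div,
      abs_of_pos hh, Complex.real_smul, ← mul_assoc, ← Complex.ofReal_mul,
      inv_mul_cancel₀ hh.ne', Complex.ofReal_one, one_mul, hH,
      integral_indicator measurableSet_Ioi]
  set D := h ^ (lam * (1 + α) + lam0) * Real.exp (1 / (mu * h ^ lam)) with hD
  have hDinv : D * (h ^ (-(lam * (1 + α) + lam0)) * Real.exp (-(1 / (mu * h ^ lam)))) = 1 := by
    rw [hD, mul_mul_mul_comm, ← Real.rpow_add hh, ← Real.exp_add, add_neg_cancel, add_neg_cancel,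
      Real.rpow_zero, Real.exp_zero, one_mul]
  have hpt : ∀ s ∈ Set.Ioo (0 : ℝ) 1, H ((1 - s) / h) =
      (D : ℂ) * (Complex.exp (((y / h : ℝ) : ℂ) * Complex.I) *
        (Complex.exp (Complex.I * ((-(s * (y / h)) : ℝ) : ℂ)) *
            normalizedIntegrand φw k α lam0 lam mu h s)) := by
    intro s hs
    have hmem : (1 - s) / h ∈ Set.Ioi (0 : ℝ) := div_pos (by linarith [hs.2]) hh
    rw [hH, Set.indicator_of_mem hmem, deconvIntegrand, normalizedIntegrand,
      mul_div_cancel₀ _ hh.ne', ← mul_assoc (Complex.exp (((y / h : ℝ) : ℂ) * Complex.I)),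
      ← Complex.exp_add]
    have e1 : Complex.I * (((1 - s) / h : ℝ) : ℂ) * y =
        ((y / h : ℝ) : ℂ) * Complex.I + Complex.I * ((-(s * (y / h)) : ℝ) : ℂ) := by
      push_cast
      ring
    rw [e1, Complex.ofReal_mul _ (φw (1 - s)), div_eq_mul_inv (φw (1 - s) : ℂ)]
    have e2 : (D : ℂ) * ((h ^ (-(lam * (1 + α) + lam0)) *
        Real.exp (-(1 / (mu * h ^ lam))) : ℝ) : ℂ) = 1 := by
      rw [← Complex.ofReal_mul, hDinv, Complex.ofReal_one]
    generalize Complex.exp (((y / h : ℝ) : ℂ) * Complex.I +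
      Complex.I * ((-(s * (y / h)) : ℝ) : ℂ)) = e
    linear_combination -(e * (φw (1 - s) * (densityCharFun k ((1 - s) / h))⁻¹)) * e2
  have hrestrict : ∫ s, H ((1 - s) / h) = ∫ s in Set.Ioo 0 1, H ((1 - s) / h) := by
    rw [← integral_indicator measurableSet_Ioo]
    refine integral_congr_ae ?_
    -- The point s = 0 is discarded because φ_w(1) need not vanish.
    filter_upwards [Measure.ae_ne volume (0 : ℝ)] with s hs0
    by_cases hs : s ∈ Set.Ioo (0 : ℝ) 1
    · rw [Set.indicator_of_mem hs]
    rw [Set.indicator_of_notMem hs, hH]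
    by_cases hs1 : s < 1
    · have hneg : s < 0 := lt_of_le_of_ne (not_lt.1 fun h0 => hs ⟨h0, hs1⟩) hs0
      have hw0 : φw (1 - s) = 0 := by
        by_contra hne
        linarith [(hW.support hne).2]
      refine Set.indicator_apply_eq_zero.2 fun _ => ?_
      rw [deconvIntegrand, mul_div_cancel₀ _ hh.ne', hw0]
      simp
    · refine Set.indicator_of_notMem (fun hmem : 0 < (1 - s) / h => ?_) _
      have := (div_pos_iff_of_pos_right hh).1 hmem
      linarith
  -- The exponent -1 in the normalisation is the Jacobian of t = (1 - s)/h.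
  have hscale : h ^ (lam * (1 + α) + lam0 - 1) = h⁻¹ * h ^ (lam * (1 + α) + lam0) := by
    rw [Real.rpow_sub_one hh.ne']
    ring
  have hpi : (1 / (2 * (Real.pi : ℂ))) = ((1 / (2 * Real.pi) : ℝ) : ℂ) := by push_cast; rfl
  rw [deconvKernel, hpi, Complex.re_ofReal_mul,
    re_integral_eq_two_mul_of_conj (integrable_deconvIntegrand hW hK hc hh y)
      (deconvIntegrand_neg hW h y), hsub, hrestrict,
    setIntegral_congr_fun measurableSet_Ioo hpt, integral_const_mul, integral_const_mul,
    Complex.re_ofReal_mul, Complex.re_ofReal_mul, hscale, hD]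
  field_simp

/-- The normalised deconvolution kernel is close to a cosine. -/
lemma abs_deconvKernel_div_sub_le (hW : ConditionW w φw A α)
    (hK : ConditionK k C lam0 lam mu) (hc : Continuous (densityCharFun k)) {h : ℝ} (hh : 0 < h)
    (L y : ℝ) :
    |deconvKernel φw k h y /
        (h ^ (lam * (1 + α) + lam0 - 1) * Real.exp (1 / (mu * h ^ lam))) -
          L / Real.pi * Real.cos (y / h)| ≤
      ‖(∫ s in Set.Ioo 0 1, normalizedIntegrand φw k α lam0 lam mu h s) - L‖ +
        |y| * (h⁻¹ * ∫ s in Set.Ioo 0 1, s * ‖normalizedIntegrand φw k α lam0 lam mu h s‖) := by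
  have hD : 0 < h ^ (lam * (1 + α) + lam0 - 1) * Real.exp (1 / (mu * h ^ lam)) :=
    mul_pos (Real.rpow_pos_of_pos hh _) (Real.exp_pos _)
  rw [deconvKernel_eq hW hK hc hh, mul_div_cancel_left₀ _ hD.ne']
  set Q := normalizedIntegrand φw k α lam0 lam mu h with hQdef
  have hQ : Integrable Q := integrable_normalizedIntegrand hW hK hc h
  have hsQ : IntegrableOn (fun s => s * ‖Q s‖) (Set.Ioo 0 1) :=
    (hQ.norm.integrableOn.continuousOn_mul continuousOn_id isCompact_Icc).mono_set
      Set.Ioo_subset_Icc_self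
  set E : ℝ → ℂ := fun s => Complex.exp (Complex.I * ((-(s * (y / h)) : ℝ) : ℂ)) with hE
  have hEc : Continuous E := by fun_prop
  have hEQ : IntegrableOn (fun s => E s * Q s) (Set.Ioo 0 1) :=
    (hQ.integrableOn.continuousOn_mul hEc.continuousOn isCompact_Icc).mono_set
      Set.Ioo_subset_Icc_self
  have hcos : L / Real.pi * Real.cos (y / h) =
      Real.pi⁻¹ * (Complex.exp (((y / h : ℝ) : ℂ) * Complex.I) * L).re := by
    rw [Complex.re_mul_ofReal, Complex.exp_ofReal_mul_I_re]
    ring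
  rw [hcos, ← mul_sub, ← Complex.sub_re, ← mul_sub, abs_mul, abs_of_pos (inv_pos.2 Real.pi_pos)]
  have h1 : |(Complex.exp (((y / h : ℝ) : ℂ) * Complex.I) *
      ((∫ s in Set.Ioo 0 1, E s * Q s) - L)).re| ≤ ‖(∫ s in Set.Ioo 0 1, E s * Q s) - L‖ := by
    refine (Complex.abs_re_le_norm _).trans (le_of_eq ?_)
    rw [norm_mul, Complex.norm_exp_ofReal_mul_I, one_mul]
  -- Uses |e^{iθ} - 1| ≤ |θ| with θ = -sy/h, which is why the first moment divided by h enters.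
  have h2 : ‖∫ s in Set.Ioo 0 1, (E s - 1) * Q s‖ ≤ |y| * (h⁻¹ * ∫ s in Set.Ioo 0 1, s * ‖Q s‖) := by
    rw [← mul_assoc, ← integral_const_mul]
    refine norm_integral_le_of_norm_le (hsQ.const_mul _) ?_
    refine (ae_restrict_iff' measurableSet_Ioo).2 (ae_of_all _ fun s hs => ?_)
    rw [norm_mul, ← mul_assoc]
    gcongr
    refine (Real.norm_exp_I_mul_ofReal_sub_one_le).trans (le_of_eq ?_)
    rw [Real.norm_eq_abs, abs_neg, abs_mul, abs_div, abs_of_pos hh, abs_of_pos hs.1]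
    ring
  have h3 : (∫ s in Set.Ioo 0 1, E s * Q s) - L =
      ((∫ s in Set.Ioo 0 1, Q s) - L) + ∫ s in Set.Ioo 0 1, (E s - 1) * Q s := by
    have : ∀ s, (E s - 1) * Q s = E s * Q s - Q s := fun s => by ring
    simp only [this]
    rw [integral_sub hEQ hQ.integrableOn]
    ring
  have hpi1 : Real.pi⁻¹ ≤ 1 := inv_le_one_of_one_le₀ (by linarith [Real.pi_gt_three])
  calc _ ≤ 1 * ‖(∫ s in Set.Ioo 0 1, E s * Q s) - L‖ := by gcongr
    _ ≤ _ := by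
      rw [one_mul, h3]
      exact (norm_add_le _ _).trans (add_le_add le_rfl h2)

end Kernel

/-! ### Law of the observations and oscillating cosine moments. -/

lemma Model.measurable_X {Ω : Type*} [MeasurableSpace Ω] {P : Measure Ω} {X Y Z : ℕ → Ω → ℝ}
    {f k : ℝ → ℝ} (hm : Model P X Y Z f k) (i : ℕ) : Measurable (X i) := by
  rw [show X i = fun ω => Y i ω + Z i ω from funext (hm.X_eq i)]
  exact (hm.measurable_Y i).add (hm.measurable_Z i)

section Limit

variable {Ω : Type*} [MeasurableSpace Ω] {P : Measure Ω} [IsProbabilityMeasure P]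

lemma integral_cos_mul_sub {X : Ω → ℝ} (hX : Measurable X) (a x : ℝ) :
    ∫ ω, Real.cos (a * (X ω - x)) ∂P =
      (Complex.exp (((-(a * x) : ℝ) : ℂ) * Complex.I) * charFun (P.map X) a).re := by
  rw [charFun_apply_real, integral_map hX.aemeasurable (by fun_prop), ← integral_const_mul]
  have hi : Integrable (fun ω => Complex.exp (((-(a * x) : ℝ) : ℂ) * Complex.I) *
      Complex.exp (a * X ω * Complex.I)) P := by
    refine Integrable.of_bound (by fun_prop) 1 (ae_of_all _ fun ω => ?_)
    rw [norm_mul, Complex.norm_exp_ofReal_mul_I, ← Complex.ofReal_mul,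
      Complex.norm_exp_ofReal_mul_I, one_mul]
  have := integral_re hi
  simp only [RCLike.re_to_complex] at this
  rw [← this]
  congr 1
  funext ω
  rw [← Complex.exp_add, ← Complex.exp_ofReal_mul_I_re]
  congr 2
  push_cast
  ring

/-- Riemann–Lebesgue type statement for a law whose characteristic function vanishes at
infinity. -/
lemma tendsto_integral_cos_zero {X : Ω → ℝ} (hX : Measurable X)
    (hcf : Tendsto (charFun (P.map X)) (cocompact ℝ) (𝓝 0)) {a : ℕ → ℝ}
    (ha : Tendsto a atTop atTop) (x : ℝ) :
    Tendsto (fun n => ∫ ω, Real.cos (a n * (X ω - x)) ∂P) atTop (𝓝 0) := by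
  refine squeeze_zero_norm (fun n => ?_)
    ((hcf.comp (ha.mono_right atTop_le_cocompact)).norm.trans (by simp))
  rw [integral_cos_mul_sub hX]
  refine (Complex.abs_re_le_norm _).trans (le_of_eq ?_)
  rw [norm_mul, Complex.norm_exp_ofReal_mul_I, one_mul]
  rfl

/-- By cos² = 1/2 + cos(2·)/2, the oscillating half vanishes at the doubled frequency. -/
lemma tendsto_integral_cos_sq {X : Ω → ℝ} (hX : Measurable X)
    (hcf : Tendsto (charFun (P.map X)) (cocompact ℝ) (𝓝 0)) {a : ℕ → ℝ}
    (ha : Tendsto a atTop atTop) (x : ℝ) :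
    Tendsto (fun n => ∫ ω, Real.cos (a n * (X ω - x)) ^ 2 ∂P) atTop (𝓝 (1 / 2)) := by
  have h1 := tendsto_integral_cos_zero hX hcf (ha.const_mul_atTop (zero_lt_two' ℝ)) x
  have h2 := (h1.div_const 2).const_add (1 / 2)
  rw [zero_div, add_zero] at h2
  refine h2.congr fun n => ?_
  have hi : Integrable (fun ω => Real.cos (2 * a n * (X ω - x)) / 2) P := by
    refine Integrable.of_bound (by fun_prop) 1 (ae_of_all _ fun ω => ?_)
    rw [Real.norm_eq_abs, abs_div, abs_two]
    linarith [Real.abs_cos_le_one (2 * a n * (X ω - x))]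
  simp only [Real.cos_sq, ← mul_assoc]
  rw [integral_add (integrable_const _) hi]
  simp [integral_div]

variable {X Y Z : ℕ → Ω → ℝ} {f k : ℝ → ℝ}

lemma Model.isProbabilityMeasure_f (hm : Model P X Y Z f k) :
    IsProbabilityMeasure (densityMeasure f) :=
  hm.law_Y 0 ▸ Measure.isProbabilityMeasure_map (hm.measurable_Y 0).aemeasurable

lemma Model.isProbabilityMeasure_k (hm : Model P X Y Z f k) :
    IsProbabilityMeasure (densityMeasure k) :=
  hm.law_Z 0 ▸ Measure.isProbabilityMeasure_map (hm.measurable_Z 0).aemeasurable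

lemma Model.charFun_X (hm : Model P X Y Z f k) (i : ℕ) :
    charFun (P.map (X i)) = charFun (densityMeasure f) * densityCharFun k := by
  rw [show X i = fun ω => Y i ω + Z i ω from funext (hm.X_eq i),
    (hm.indep_YZ i).charFun_map_fun_add_eq_mul (hm.measurable_Y i).aemeasurable
      (hm.measurable_Z i).aemeasurable, hm.law_Y, hm.law_Z]
  rfl

/-- Identical distribution is derived rather than assumed: every X_i has characteristic function φ_f
φ_k. -/
lemma Model.map_X (hm : Model P X Y Z f k) (i : ℕ) : P.map (X i) = P.map (X 0) := by
  have := fun i => Measure.isProbabilityMeasure_map (μ := P) (hm.measurable_X i).aemeasurable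
  refine Measure.ext_of_charFun ?_
  rw [hm.charFun_X, hm.charFun_X]

lemma Model.tendsto_charFun_X (hm : Model P X Y Z f k) {C lam0 lam mu : ℝ}
    (hK : ConditionK k C lam0 lam mu) (i : ℕ) :
    Tendsto (charFun (P.map (X i))) (cocompact ℝ) (𝓝 0) := by
  have := hm.isProbabilityMeasure_f
  rw [hm.charFun_X]
  refine squeeze_zero_norm (fun t => ?_) (hK.tendsto_zero.norm.trans (by simp))
  rw [Pi.mul_apply, norm_mul]
  exact mul_le_of_le_one_left (norm_nonneg _) (norm_charFun_le_one t)

lemma Model.continuous_densityCharFun (hm : Model P X Y Z f k) :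
    Continuous (densityCharFun k) := by
  have := hm.isProbabilityMeasure_k
  exact continuous_charFun

end Limit

end Deconvolution

/-! ### Assembly of the limit theorem. -/

open Deconvolution

theorem mainTheorem5 {Ω : Type*} [MeasurableSpace Ω] (P : Measure Ω) [IsProbabilityMeasure P]
    (X Y Z : ℕ → Ω → ℝ) (f k : ℝ → ℝ) (hmodel : Deconvolution.Model P X Y Z f k)
    (hX2 : ∀ i, MemLp (X i) 2 P)
    (w φw : ℝ → ℝ) (A α : ℝ) (hW : Deconvolution.ConditionW w φw A α)
    (C lam0 lam mu : ℝ) (hK : Deconvolution.ConditionK k C lam0 lam mu)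
    (h : ℕ → ℝ) (hpos : ∀ n, 0 < h n) (hlim : Tendsto h atTop (𝓝 0)) (x : ℝ) :
    (∀ n, Integrable (fun ω => Deconvolution.estimator φw k n (h n) (fun j => X j ω) x) P) ∧
    TendstoInDistribution
      (fun (n : ℕ) (ω : Ω) =>
        Real.sqrt n /
            (h n ^ (lam * (1 + α) + lam0 - 1) * Real.exp (1 / (mu * h n ^ lam))) *
          (Deconvolution.estimator φw k n (h n) (fun j => X j ω) x -
            ∫ ω', Deconvolution.estimator φw k n (h n) (fun j => X j ω') x ∂P))
      atTop (id : ℝ → ℝ) (fun _ => P)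
      (gaussianReal 0 (Real.toNNReal
        (A ^ 2 / (2 * Real.pi ^ 2 * C ^ 2) * (mu / lam) ^ (2 + 2 * α) *
          Real.Gamma (α + 1) ^ 2))) := by
  have hc := hmodel.continuous_densityCharFun
  have hXm := hmodel.measurable_X
  have hKm : ∀ n, Continuous (deconvKernel φw k (h n)) := fun n =>
    continuous_deconvKernel hW hK hc (hpos n)
  have hest : ∀ n ω, estimator φw k n (h n) (fun j => X j ω) x =
      (n : ℝ)⁻¹ * ∑ j ∈ Finset.range n, deconvKernel φw k (h n) (X j ω - x) := fun n ω =>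
    estimator_eq_sum_deconvKernel hW hK hc (hpos n) n _ x
  have hmem : ∀ n j, MemLp (fun ω => deconvKernel φw k (h n) (X j ω - x)) 2 P := fun n j => by
    obtain ⟨B, hB⟩ := exists_abs_deconvKernel_le φw k (h n)
    exact MemLp.of_bound ((hKm n).measurable.comp ((hXm j).sub_const x)).aestronglyMeasurable B
      (ae_of_all _ fun ω => hB _)
  have hKi : ∀ n j, Integrable (fun ω => deconvKernel φw k (h n) (X j ω - x)) P := fun n j =>
    (hmem n j).integrable one_le_two
  have hident : ∀ n j, ∫ ω, deconvKernel φw k (h n) (X j ω - x) ∂P =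
      ∫ ω, deconvKernel φw k (h n) (X 0 ω - x) ∂P := fun n j =>
    ((IdentDistrib.mk (hXm j).aemeasurable (hXm 0).aemeasurable (hmodel.map_X j)).comp
      ((hKm n).measurable.comp (measurable_id.sub_const x))).integral_eq
  refine ⟨fun n => ?_, ?_⟩
  · simp only [hest]
    exact (integrable_finsetSum _ fun j _ => hKi n j).const_mul _
  set L : ℝ := A / C * (mu / lam) ^ (1 + α) * Real.Gamma (α + 1) with hL
  set D : ℕ → ℝ := fun n => h n ^ (lam * (1 + α) + lam0 - 1) * Real.exp (1 / (mu * h n ^ lam))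
    with hDdef
  have hv : A ^ 2 / (2 * Real.pi ^ 2 * C ^ 2) * (mu / lam) ^ (2 + 2 * α) *
      Real.Gamma (α + 1) ^ 2 = (L / Real.pi) ^ 2 * (1 / 2) := by
    have hml : 0 < mu / lam := div_pos hK.mu_pos (zero_lt_one.trans hK.lam_gt_one)
    have e1 : (mu / lam) ^ (2 + 2 * α) = ((mu / lam) ^ (1 + α)) ^ 2 := by
      rw [← Real.rpow_natCast, ← Real.rpow_mul hml.le]
      congr 1
      push_cast
      ring
    rw [e1, hL]
    have := hK.C_ne_zero
    field_simp
  have hinv : Tendsto (fun n => (h n)⁻¹) atTop atTop :=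
    tendsto_inv_nhdsGT_zero.comp
      (tendsto_nhdsWithin_iff.2 ⟨hlim, Eventually.of_forall hpos⟩)
  have hcf := hmodel.tendsto_charFun_X hK 0
  set g : ℕ → ℝ → ℝ := fun n y => L / Real.pi * Real.cos ((h n)⁻¹ * (y - x)) with hg
  have hgm : ∀ n, Measurable (g n) := fun n => by fun_prop
  have hgM : ∀ n y, |g n y| ≤ |L / Real.pi| := fun n y => by
    rw [hg, abs_mul]
    exact mul_le_of_le_one_right (abs_nonneg _) (Real.abs_cos_le_one _)
  have hg1 : Tendsto (fun n => ∫ ω, g n (X 0 ω) ∂P) atTop (𝓝 0) := by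
    have := (tendsto_integral_cos_zero (hXm 0) hcf hinv x).const_mul (L / Real.pi)
    rw [mul_zero] at this
    exact this.congr fun n => (integral_const_mul _ _).symm
  have hg2 : Tendsto (fun n => ∫ ω, g n (X 0 ω) ^ 2 ∂P) atTop
      (𝓝 ((L / Real.pi) ^ 2 * (1 / 2))) := by
    refine ((tendsto_integral_cos_sq (hXm 0) hcf hinv x).const_mul ((L / Real.pi) ^ 2)).congr
      fun n => ?_
    rw [← integral_const_mul]
    simp only [hg, mul_pow]
  have hclt := tendstoInDistribution_of_bounded_array hXm hmodel.indep_X hmodel.map_X hgm hgM hg1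
    (by positivity) hg2
  -- Remainder of the normalised kernel after subtraction of its cosine approximation.
  set R : ℕ → ℝ → ℝ := fun n y => deconvKernel φw k (h n) (y - x) / D n - g n y with hR
  have hRm : ∀ n, Measurable (R n) := fun n =>
    (((hKm n).measurable.comp (measurable_id.sub_const x)).div_const _).sub (hgm n)
  have hgL : ∀ n, MemLp (fun ω => g n (X 0 ω)) 2 P := fun n =>
    MemLp.of_bound ((hgm n).comp (hXm 0)).aestronglyMeasurable _ (ae_of_all _ fun ω => hgM n _)
  have hRL : ∀ n, MemLp (fun ω => R n (X 0 ω)) 2 P := fun n => by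
    refine MemLp.sub ?_ (hgL n)
    simp only [div_eq_mul_inv]
    exact (hmem n 0).mul_const _
  -- The remainder is at most a_n + |X - x| b_n with a_n, b_n → 0, so the finite second moment of X
  -- gives convergence in L².
  have hR2 : Tendsto (fun n => ∫ ω, R n (X 0 ω) ^ 2 ∂P) atTop (𝓝 0) := by
    obtain ⟨t1, t2⟩ := tendsto_integral_and_moment_normalizedIntegrand hW hK hc
    have hh : Tendsto h atTop (𝓝[>] 0) :=
      tendsto_nhdsWithin_iff.2 ⟨hlim, Eventually.of_forall hpos⟩
    set a : ℕ → ℝ := fun n => ‖(∫ s in Set.Ioo 0 1,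
      normalizedIntegrand φw k α lam0 lam mu (h n) s) - (L : ℂ)‖
    set b : ℕ → ℝ := fun n => (h n)⁻¹ * ∫ s in Set.Ioo 0 1,
      s * ‖normalizedIntegrand φw k α lam0 lam mu (h n) s‖
    have ha : Tendsto a atTop (𝓝 0) := tendsto_iff_norm_sub_tendsto_zero.1 (t1.comp hh)
    have hb : Tendsto b atTop (𝓝 0) := t2.comp hh
    have hXx : MemLp (fun ω => X 0 ω - x) 2 P := (hX2 0).sub (memLp_const x)
    set m := ∫ ω, (X 0 ω - x) ^ 2 ∂P
    have hlim2 : Tendsto (fun n => 2 * a n ^ 2 + 2 * b n ^ 2 * m) atTop (𝓝 0) := by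
      simpa using ((ha.pow 2).const_mul 2).add (((hb.pow 2).const_mul 2).mul_const m)
    refine squeeze_zero (fun n => integral_nonneg fun ω => sq_nonneg _) (fun n => ?_) hlim2
    have hi : Integrable (fun ω => 2 * a n ^ 2 + 2 * b n ^ 2 * (X 0 ω - x) ^ 2) P :=
      (integrable_const _).add (hXx.integrable_sq.const_mul _)
    have hle : ∀ ω, R n (X 0 ω) ^ 2 ≤ 2 * a n ^ 2 + 2 * b n ^ 2 * (X 0 ω - x) ^ 2 := fun ω => by
      have h1 : |R n (X 0 ω)| ≤ a n + |X 0 ω - x| * b n := by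
        have := abs_deconvKernel_div_sub_le hW hK hc (hpos n) L (X 0 ω - x)
        rw [div_eq_inv_mul (X 0 ω - x)] at this
        exact this
      calc R n (X 0 ω) ^ 2 = |R n (X 0 ω)| ^ 2 := (sq_abs _).symm
        _ ≤ (a n + |X 0 ω - x| * b n) ^ 2 := by gcongr
        _ ≤ 2 * (a n ^ 2 + (|X 0 ω - x| * b n) ^ 2) := add_sq_le
        _ = _ := by rw [mul_pow, sq_abs]; ring
    refine (integral_mono (hRL n).integrable_sq hi hle).trans (le_of_eq ?_)
    rw [integral_add (integrable_const _) (hXx.integrable_sq.const_mul _)]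
    simp [m, integral_const_mul]
  have hrem := tendstoInMeasure_of_tendsto_second_moment hXm hmodel.indep_X hmodel.map_X hRm hRL hR2
  -- Slutsky's theorem; the sum of the two centred sums is then identified with the normalised
  -- estimator.
  have hsum := hclt.add_of_tendstoInMeasure_const hrem fun n =>
    (measurable_const.mul (Finset.measurable_sum _ fun j _ =>
      ((hRm n).comp (hXm j)).sub_const _)).aemeasurable
  rw [hv]
  refine hsum.congr (fun n => ae_of_all _ fun ω => ?_) (ae_of_all _ fun y => by simp)
  simp only [Pi.add_apply]
  have hmean : ∫ ω', estimator φw k n (h n) (fun j => X j ω') x ∂P =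
      (n : ℝ)⁻¹ * ∑ j ∈ Finset.range n, ∫ ω, deconvKernel φw k (h n) (X 0 ω - x) ∂P := by
    simp only [hest]
    rw [integral_const_mul, integral_finsetSum _ fun j _ => hKi n j]
    simp only [hident]
  have hRint : ∫ ω, R n (X 0 ω) ∂P =
      (∫ ω, deconvKernel φw k (h n) (X 0 ω - x) ∂P) / D n - ∫ ω, g n (X 0 ω) ∂P := by
    rw [← integral_div, ← integral_sub ((hKi n 0).div_const _) ((hgL n).integrable one_le_two)]
  rw [hmean, hest, hRint, ← mul_add, ← Finset.sum_add_distrib, ← mul_sub,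
    ← Finset.sum_sub_distrib]
  have hterm : ∀ j, g n (X j ω) - ∫ ω', g n (X 0 ω') ∂P + (R n (X j ω) -
      ((∫ ω, deconvKernel φw k (h n) (X 0 ω - x) ∂P) / D n - ∫ ω, g n (X 0 ω) ∂P)) =
      (D n)⁻¹ * (deconvKernel φw k (h n) (X j ω - x) -
        ∫ ω, deconvKernel φw k (h n) (X 0 ω - x) ∂P) := fun j => by
    simp only [hR]
    ring
  simp only [hterm, ← Finset.mul_sum]
  rw [← mul_assoc, ← mul_assoc]
  congr 1
  have hsqrt : Real.sqrt n * (n : ℝ)⁻¹ = (Real.sqrt n)⁻¹ := by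
    rw [← div_eq_mul_inv, Real.sqrt_div_self', one_div]
  rw [div_mul_eq_mul_div, hsqrt, ← div_eq_mul_inv]
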